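/- Consider $T$ periods with unit production, inventory and backordering costs $c^P$, $c^I\ge 0$, $c^B\ge 0$, unit selling price $b^P\ge 0$, nominal cumulative demands $\widehat D_1,\dots,\widehat D_T$, maximal deviations $\Delta_1,\dots,\Delta_T\in\mathbb Z_{\ge 0}$ with $\Delta_t\le \widehat D_t$, a budget $\Gamma^c\in\mathbb Z_{\ge 0}$, and a production plan $x_1,\dots,x_T\ge 0$; all data are rational. Put $X_t=\sum_{i\le t}x_i$, $$f_I(X_t,D_t)=\begin{cases}c^I(X_t-D_t)& t<T,\\ c^I(X_t-D_t)+c^PX_t-b^PD_t& t=T,\end{cases}\qquad f_B(X_t,D_t)=\begin{cases}c^B(D_t-X_t)& t<T,\\ c^B(D_t-X_t)+c^PX_t-b^PX_t& t=T,\end{cases}$$ $F(D)=\sum_{t=1}^T\max\{f_I(X_t,D_t),f_B(X_t,D_t)\}$, and $$\mathcal U^c=\Big\{D\in\mathbb R^T:\ D_t\le D_{t+1}\ (t<T),\ \ |D_t-\widehat D_t|\le\Delta_t\ (t\le T),\ \ \sum_{t=1}^T|D_t-\widehat D_t|\le\Gamma^c\Big\}.$$ Assume that the intervals are non-overlapping,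 i.e. $\widehat D_t+\Delta_t\le\widehat D_{t+1}-\Delta_{t+1}$ for $t<T$, and that $F(\widehat D)\ge 0$ (this holds in particular if all scenarios in $\mathcal U^c$ have nonnegative cost). The problem Adv asks for a scenario $D\in\mathcal U^c$ that maximizes $F(D)$. Then Adv admits an FPTAS: there are an algorithm (a program of a random access machine with logarithmic cost) and a polynomial $p$ such that for every such instance and every real $\varepsilon>0$ the algorithm, given the instance and the integer $\lceil 1/\varepsilon\rceil$, returns a rational scenario $D\in\mathcal U^c$ with $$\max_{D'\in\mathcal U^c}F(D')\ \le\ (1+\varepsilon)\,F(D)$$ (where the maximum exists) in time at most $p(\text{size},1/\varepsilon)$, where size denotes the number of periods plus the total binary length of the data. -/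

import Mathlib

/-! ## Machine model: a random access machine with logarithmic cost -/

namespace RAM

/-- The memory of the machine: integer registers, and finitely many relevant integer arrays
(a program mentions only finitely many register and array names). -/
structure State where
  reg : ℕ → ℤ
  arr : ℕ → ℕ → ℤ

/-- Number of binary digits of `|z|`. -/
def len (z : ℤ) : ℕ := Nat.size z.natAbs

/-- Arithmetic expressions; `get A e` is the entry of the array `A` at the index `e`. -/
inductive Expr where
  | lit (z : ℤ)
  | reg (r : ℕ)
  | get (A : ℕ) (e : Expr)
  | add (e₁ e₂ : Expr)
  | sub (e₁ e₂ : Expr)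
  | mul (e₁ e₂ : Expr)
  | div (e₁ e₂ : Expr)

/-- Value of an expression; `div` is integer division (rounding down for a positive divisor),
with value `0` when the divisor is `0`. -/
def Expr.eval (s : State) : Expr → ℤ
  | .lit z => z
  | .reg r => s.reg r
  | .get A e => s.arr A (e.eval s).toNat
  | .add e₁ e₂ => e₁.eval s + e₂.eval s
  | .sub e₁ e₂ => e₁.eval s - e₂.eval s
  | .mul e₁ e₂ => e₁.eval s * e₂.eval s
  | .div e₁ e₂ => e₁.eval s / e₂.eval s

/-- Logarithmic cost of evaluating an expression: every elementary operation is charged one plus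
the bit lengths of the numbers (operands, addresses, contents) it handles. -/
def Expr.cost (s : State) : Expr → ℕ
  | .lit z => 1 + len z
  | .reg r => 1 + len (s.reg r)
  | .get A e => e.cost s + (1 + len (e.eval s) + len (s.arr A (e.eval s).toNat))
  | .add e₁ e₂ => e₁.cost s + e₂.cost s + (1 + len (e₁.eval s) + len (e₂.eval s))
  | .sub e₁ e₂ => e₁.cost s + e₂.cost s + (1 + len (e₁.eval s) + len (e₂.eval s))
  | .mul e₁ e₂ => e₁.cost s + e₂.cost s + (1 + len (e₁.eval s) + len (e₂.eval s))
  | .div e₁ e₂ => e₁.cost s + e₂.cost s + (1 + len (e₁.eval s) + len (e₂.eval s))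

/-- Programs. `set r e` assigns to a register, `put A i e` assigns to the array entry `A[i]`;
tests are of the form `e > 0`. -/
inductive Prog where
  | skip
  | set (r : ℕ) (e : Expr)
  | put (A : ℕ) (i e : Expr)
  | seq (p q : Prog)
  | ite (e : Expr) (p q : Prog)
  | loop (e : Expr) (p : Prog)

/-- The state after writing `z` to the register `r`. -/
def State.setReg (s : State) (r : ℕ) (z : ℤ) : State :=
  { s with reg := Function.update s.reg r z }

/-- The state after writing `z` to the entry `i` of the array `A`. -/
def State.setArr (s : State) (A i : ℕ) (z : ℤ) : State :=
  { s with arr := Function.update s.arr A (Function.update (s.arr A) i z) }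

/-- `Exec p s s' n`: the program `p`, started in the state `s`, halts in the state `s'`,
and its running time (total logarithmic cost) is `n`. -/
inductive Exec : Prog → State → State → ℕ → Prop where
  | skip (s : State) : Exec .skip s s 1
  | set (s : State) (r : ℕ) (e : Expr) :
      Exec (.set r e) s (s.setReg r (e.eval s)) (e.cost s + (1 + len (e.eval s)))
  | put (s : State) (A : ℕ) (i e : Expr) :
      Exec (.put A i e) s (s.setArr A (i.eval s).toNat (e.eval s))
        (i.cost s + e.cost s + (1 + len (i.eval s) + len (e.eval s)))
  | seq {p q : Prog} {s s₁ s₂ : State} {m n : ℕ} :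
      Exec p s s₁ m → Exec q s₁ s₂ n → Exec (.seq p q) s s₂ (m + n)
  | iteTrue {e : Expr} {p q : Prog} {s s₁ : State} {n : ℕ} :
      0 < e.eval s → Exec p s s₁ n → Exec (.ite e p q) s s₁ (e.cost s + 1 + n)
  | iteFalse {e : Expr} {p q : Prog} {s s₁ : State} {n : ℕ} :
      e.eval s ≤ 0 → Exec q s s₁ n → Exec (.ite e p q) s s₁ (e.cost s + 1 + n)
  | loopDone {e : Expr} {p : Prog} {s : State} :
      e.eval s ≤ 0 → Exec (.loop e p) s s (e.cost s + 1)
  | loopStep {e : Expr} {p : Prog} {s s₁ s₂ : State} {m n : ℕ} :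
      0 < e.eval s → Exec p s s₁ m → Exec (.loop e p) s₁ s₂ n →
      Exec (.loop e p) s s₂ (e.cost s + 1 + m + n)

end RAM

/-! ## The adversarial lot sizing problem under continuous budgeted uncertainty -/

/-- Data of an instance of the adversarial problem: `T` periods, costs and selling price,
nominal cumulative demands `Dhat`, integral maximal deviations `Δ`, integral budget `Γ`, and
the production plan `x` to be evaluated. Periods are numbered from `0` to `T - 1`. -/
structure AdvInstance where
  T : ℕ
  cP : ℚ
  cI : ℚ
  cB : ℚ
  bP : ℚ
  Dhat : Fin T → ℚ
  Δ : Fin T → ℕ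
  Γ : ℕ
  x : Fin T → ℚ

namespace AdvInstance

/-- Cumulative production up to period `t`. -/
noncomputable def X (I : AdvInstance) (t : Fin I.T) : ℝ :=
  ∑ i ∈ Finset.univ.filter (fun i => i ≤ t), (I.x i : ℝ)

/-- Cost of period `t` if cumulative production `X` is at least cumulative demand `D`. -/
noncomputable def fI (I : AdvInstance) (t : Fin I.T) (X D : ℝ) : ℝ :=
  if (t : ℕ) + 1 = I.T then I.cI * (X - D) + I.cP * X - I.bP * D else I.cI * (X - D)

/-- Cost of period `t` if cumulative production `X` is at most cumulative demand `D`. -/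
noncomputable def fB (I : AdvInstance) (t : Fin I.T) (X D : ℝ) : ℝ :=
  if (t : ℕ) + 1 = I.T then I.cB * (D - X) + I.cP * X - I.bP * X else I.cB * (D - X)

/-- Total cost of the production plan under the cumulative demand scenario `D`. -/
noncomputable def cost (I : AdvInstance) (D : Fin I.T → ℝ) : ℝ :=
  ∑ t, max (I.fI t (I.X t) (D t)) (I.fB t (I.X t) (D t))

/-- The nominal scenario, as a real vector. -/
def nominal (I : AdvInstance) (t : Fin I.T) : ℝ := (I.Dhat t : ℝ)

/-- The continuous budgeted uncertainty set. -/
def Uc (I : AdvInstance) : Set (Fin I.T → ℝ) :=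
  {D | (∀ s t : Fin I.T, (s : ℕ) + 1 = t → D s ≤ D t) ∧
    (∀ t, D t ∈ Set.Icc (I.nominal t - I.Δ t) (I.nominal t + I.Δ t)) ∧
    ∑ t, |D t - I.nominal t| ≤ I.Γ}

/-- Admissible instances: nonnegative inventory and backordering costs, selling price and
production amounts, deviations at most the nominal values, non-overlapping cumulative demand
intervals, and a nonnegative cost of the nominal scenario. -/
structure Admissible (I : AdvInstance) : Prop where
  cI_nonneg : 0 ≤ I.cI
  cB_nonneg : 0 ≤ I.cB
  bP_nonneg : 0 ≤ I.bP
  x_nonneg : ∀ t, 0 ≤ I.x t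
  Δ_le : ∀ t, (I.Δ t : ℚ) ≤ I.Dhat t
  nonoverlapping : ∀ s t : Fin I.T, (s : ℕ) + 1 = t →
    I.Dhat s + (I.Δ s : ℚ) ≤ I.Dhat t - (I.Δ t : ℚ)
  cost_nominal_nonneg : 0 ≤ I.cost I.nominal

/-- Bit length of a rational number, written as a reduced fraction in binary. -/
def ratLen (q : ℚ) : ℕ := Nat.size q.num.natAbs + Nat.size q.den

/-- Size of an instance: number of periods plus the total binary length of all data. -/
def size (I : AdvInstance) : ℕ :=
  I.T + ratLen I.cP + ratLen I.cI + ratLen I.cB + ratLen I.bP + Nat.size I.Γ +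
    ∑ t, (ratLen (I.Dhat t) + Nat.size (I.Δ t) + ratLen (I.x t))

/-- A finite vector as the contents of an array (zero beyond its length). -/
def toArr {T : ℕ} (v : Fin T → ℤ) (i : ℕ) : ℤ := if h : i < T then v ⟨i, h⟩ else 0

/-- Initial memory of the machine for the instance `I` and the accuracy parameter `k`: the plain
data of the instance, rational numbers being given by numerator and denominator. -/
def input (I : AdvInstance) (k : ℕ) : RAM.State where
  reg r := match r with
    | 0 => I.T
    | 1 => k
    | 2 => I.Γ
    | 3 => I.cP.num
    | 4 => I.cP.den
    | 5 => I.cI.num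
    | 6 => I.cI.den
    | 7 => I.cB.num
    | 8 => I.cB.den
    | 9 => I.bP.num
    | 10 => I.bP.den
    | _ => 0
  arr A := match A with
    | 0 => toArr fun t => (I.Dhat t).num
    | 1 => toArr fun t => ((I.Dhat t).den : ℤ)
    | 2 => toArr fun t => (I.Δ t : ℤ)
    | 3 => toArr fun t => (I.x t).num
    | 4 => toArr fun t => ((I.x t).den : ℤ)
    | _ => fun _ => 0

/-- `I.Returns s D`: the final memory `s` contains the scenario `D`, with the numerator of `D t` in
array `5` and a positive denominator of `D t` in array `6`. -/
def Returns (I : AdvInstance) (s : RAM.State) (D : Fin I.T → ℝ) : Prop :=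
  ∀ t : Fin I.T, 0 < s.arr 6 t ∧ D t = (s.arr 5 t : ℝ) / (s.arr 6 t : ℝ)

/-- `I.IsOPT v`: the maximum of the cost over the uncertainty set exists and equals `v`. -/
def IsOPT (I : AdvInstance) (v : ℝ) : Prop := IsGreatest (I.cost '' I.Uc) v

end AdvInstance

/-- `IsAdvFPTAS P`: the program `P` is a fully polynomial approximation scheme for the maximization
problem of finding a worst scenario in the continuous budgeted uncertainty set. One program serves
all instances and accuracies; it receives `ε` through the integer `⌈1 / ε⌉`, and its running time
is bounded by a polynomial in the size of the instance and `1 / ε`. -/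
def IsAdvFPTAS (P : RAM.Prog) : Prop :=
  ∃ p : MvPolynomial (Fin 2) ℝ, ∀ I : AdvInstance, I.Admissible → ∀ ε : ℝ, 0 < ε →
    ∃ (s : RAM.State) (n : ℕ) (D : Fin I.T → ℝ) (OPT : ℝ),
      RAM.Exec P (I.input ⌈1 / ε⌉₊) s n ∧
      (n : ℝ) ≤ MvPolynomial.eval ![(I.size : ℝ), 1 / ε] p ∧
      I.Returns s D ∧ D ∈ I.Uc ∧
      I.IsOPT OPT ∧ OPT ≤ (1 + ε) * I.cost D

/-! ## Running programs with bounded memory contents -/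

namespace RAM

/-! Since the demand intervals do not overlap, every scenario inside the box is automatically
monotone (`mem_Uc_of_abs_le`), so only the absolute deviations and their total are constrained. The
cost of a period is a maximum of two affine functions of its demand. If a deviation of size u is
given its better sign, the period gains over its nominal cost a nondecreasing convex function of u
with two pieces (`scaledPeriodCost_add_gain`). What remains is to distribute a budget over separable
convex gains.

This knapsack problem is rounded in the classical way. Let LB be the largest gain that a single
period can achieve alone. The optimal gain is at least LB, and no period gains more than LB. Gains
are rounded down to multiples of LB / N, and a dynamic program finds for each rounded total the
largest budget that can be left over. Rounding loses at most T · LB / N ≤ LB / k when N ≥ kT, which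
gives the factor 1 + 1/k for the gains (`gain_le_solution`). Because the nominal cost is
nonnegative, the factor carries over to the whole cost (`cost_le_output`); the choice k = ⌈1/ε⌉
finishes.

On the machine all quantities are multiplied by `scale`, chosen so that every breakpoint amount is
an integer and the divisions are exact. All stored numbers are at most the 24th power of 2 ^ (size +
k), and all loops run at most `width` times, a cubic quantity. The time bound then follows from the
syntax of the program alone (`exists_timeWeight_le`), once the predicate `Runs` has been verified
for it. -/

instance : Add Expr := ⟨.add⟩
instance : Sub Expr := ⟨.sub⟩
instance : Mul Expr := ⟨.mul⟩
instance : Div Expr := ⟨.div⟩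

/-! ### Evaluation of expressions, including branch-free conditionals. -/

section Eval

variable (s : State)

@[simp] theorem eval_lit (z : ℤ) : (Expr.lit z).eval s = z := rfl
@[simp] theorem eval_reg (r : ℕ) : (Expr.reg r).eval s = s.reg r := rfl
@[simp] theorem eval_get (A : ℕ) (e : Expr) :
    (Expr.get A e).eval s = s.arr A (e.eval s).toNat := rfl
@[simp] theorem eval_add (e₁ e₂ : Expr) : (e₁ + e₂).eval s = e₁.eval s + e₂.eval s := rfl
@[simp] theorem eval_sub (e₁ e₂ : Expr) : (e₁ - e₂).eval s = e₁.eval s - e₂.eval s := rfl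
@[simp] theorem eval_mul (e₁ e₂ : Expr) : (e₁ * e₂).eval s = e₁.eval s * e₂.eval s := rfl
@[simp] theorem eval_div (e₁ e₂ : Expr) : (e₁ / e₂).eval s = e₁.eval s / e₂.eval s := rfl

/-- The value `1` if `e` is positive, and `0` otherwise. -/
def Expr.pos (e : Expr) : Expr := .lit 1 + (e - .lit 1) / (e * e + .lit 1)

-- For an integer z > 0 one has 0 ≤ z - 1 < z² + 1, so the quotient is 0. For z ≤ 0 one has -(z² +
-- 1) ≤ z - 1 < 0, because z² + z ≥ 0 for integers, and the floor is -1.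
@[simp] theorem eval_pos (e : Expr) : e.pos.eval s = if 0 < e.eval s then 1 else 0 := by
  simp only [Expr.pos, eval_add, eval_lit, eval_div, eval_sub, eval_mul]
  generalize e.eval s = z
  split_ifs with h
  · rw [Int.ediv_eq_zero_of_lt (by omega) (by nlinarith)]; rfl
  · have : (z - 1) / (z * z + 1) = -1 := by
      rw [Int.ediv_eq_iff_of_pos (by nlinarith)]
      constructor <;> nlinarith
    omega

/-- The value of `a` if `c` is positive, and the value of `b` otherwise. -/
def Expr.cond (c a b : Expr) : Expr := b + (a - b) * c.pos

@[simp] theorem eval_cond (c a b : Expr) :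
    (c.cond a b).eval s = if 0 < c.eval s then a.eval s else b.eval s := by
  simp only [Expr.cond, eval_add, eval_mul, eval_sub, eval_pos]
  split_ifs <;> ring

/-- The maximum of two values. -/
def Expr.max (a b : Expr) : Expr := (a - b).cond a b

@[simp] theorem eval_max (a b : Expr) :
    (a.max b).eval s = Max.max (a.eval s) (b.eval s) := by
  simp only [Expr.max, eval_cond, eval_sub]
  split_ifs <;> omega

/-- The minimum of two values. -/
def Expr.min (a b : Expr) : Expr := (a - b).cond b a

@[simp] theorem eval_min (a b : Expr) :
    (a.min b).eval s = Min.min (a.eval s) (b.eval s) := by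
  simp only [Expr.min, eval_cond, eval_sub]
  split_ifs <;> omega

@[simp] theorem reg_setReg (r r' : ℕ) (z : ℤ) :
    (s.setReg r z).reg r' = if r' = r then z else s.reg r' := by
  simp [State.setReg, Function.update_apply]

@[simp] theorem arr_setReg (r : ℕ) (z : ℤ) : (s.setReg r z).arr = s.arr := rfl

@[simp] theorem reg_setArr (A i : ℕ) (z : ℤ) : (s.setArr A i z).reg = s.reg := rfl

@[simp] theorem arr_setArr (A i A' i' : ℕ) (z : ℤ) :
    (s.setArr A i z).arr A' i' = if A' = A ∧ i' = i then z else s.arr A' i' := by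
  by_cases h : A' = A
  · subst h; simp [State.setArr, Function.update_apply]
  · simp [State.setArr, h]

end Eval

/-! ### Bit lengths of the results of arithmetic operations. -/

section Len

theorem len_le {z : ℤ} {b : ℕ} : len z ≤ b ↔ z.natAbs < 2 ^ b := Nat.size_le

theorem natAbs_lt (z : ℤ) : z.natAbs < 2 ^ len z := Nat.lt_size_self _

theorem len_mul (x y : ℤ) : len (x * y) ≤ len x + len y := by
  rw [len_le, Int.natAbs_mul, pow_add]
  exact Nat.mul_lt_mul'' (natAbs_lt x) (natAbs_lt y)

theorem len_of_natAbs_le_add {x y z : ℤ} (h : z.natAbs ≤ x.natAbs + y.natAbs) :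
    len z ≤ len x + len y := by
  rw [len_le]
  have hx := natAbs_lt x
  have hy := natAbs_lt y
  rw [pow_add]
  have h1 : 1 ≤ 2 ^ len x := Nat.one_le_two_pow
  have h2 : 1 ≤ 2 ^ len y := Nat.one_le_two_pow
  generalize 2 ^ len x = p at *
  generalize 2 ^ len y = q at *
  nlinarith

theorem len_ediv (x y : ℤ) : len (x / y) ≤ len x :=
  Nat.size_le_size (Int.natAbs_ediv_le_natAbs x y)

end Len

/-- All registers and array entries have at most `B` binary digits. -/
def State.Bounded (B : ℕ) (s : State) : Prop :=
  (∀ r, len (s.reg r) ≤ B) ∧ ∀ A i, len (s.arr A i) ≤ B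

theorem State.Bounded.setReg {B : ℕ} {s : State} (hs : s.Bounded B) {r : ℕ} {z : ℤ}
    (hz : len z ≤ B) : (s.setReg r z).Bounded B := by
  refine ⟨fun r' => ?_, hs.2⟩
  rw [reg_setReg]
  split_ifs
  exacts [hz, hs.1 r']

theorem State.Bounded.setArr {B : ℕ} {s : State} (hs : s.Bounded B) {A i : ℕ} {z : ℤ}
    (hz : len z ≤ B) : (s.setArr A i z).Bounded B := by
  refine ⟨hs.1, fun A' i' => ?_⟩
  rw [arr_setArr]
  split_ifs
  exacts [hz, hs.2 A' i']

/-- The length of a value of `e` is at most this number times the length of the memory contents. -/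
def Expr.valueWeight : Expr → ℕ
  | .lit z => len z
  | .reg _ => 1
  | .get _ _ => 1
  | .add e₁ e₂ | .sub e₁ e₂ | .mul e₁ e₂ => e₁.valueWeight + e₂.valueWeight
  | .div e₁ _ => e₁.valueWeight

/-- The cost of evaluating `e` is at most this number times the length of the memory contents. -/
def Expr.costWeight : Expr → ℕ
  | .lit z => 1 + len z
  | .reg _ => 2
  | .get _ e => e.costWeight + (2 + e.valueWeight)
  | .add e₁ e₂ | .sub e₁ e₂ | .mul e₁ e₂ | .div e₁ e₂ =>
    e₁.costWeight + e₂.costWeight + (1 + e₁.valueWeight + e₂.valueWeight)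

/-! ### Values and costs of expressions over a memory with bounded contents. -/

section Weight

variable {B : ℕ} {s : State} (hB : 0 < B) (hs : s.Bounded B)

include hB hs

theorem len_eval_le (e : Expr) : len (e.eval s) ≤ e.valueWeight * B := by
  induction e with
  | lit z => exact Nat.le_mul_of_pos_right _ hB
  | reg r => simpa [Expr.valueWeight] using hs.1 r
  | get A e => simpa [Expr.valueWeight] using hs.2 A _
  | add e₁ e₂ h₁ h₂ =>
    rw [Expr.valueWeight, add_mul]
    exact (len_of_natAbs_le_add (Int.natAbs_add_le _ _)).trans (add_le_add h₁ h₂)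
  | sub e₁ e₂ h₁ h₂ =>
    rw [Expr.valueWeight, add_mul]
    exact (len_of_natAbs_le_add (Int.natAbs_sub_le _ _)).trans (add_le_add h₁ h₂)
  | mul e₁ e₂ h₁ h₂ =>
    rw [Expr.valueWeight, add_mul]
    exact (len_mul _ _).trans (add_le_add h₁ h₂)
  | div e₁ e₂ h₁ h₂ => exact (len_ediv _ _).trans h₁

theorem cost_le (e : Expr) : e.cost s ≤ e.costWeight * B := by
  induction e with
  | lit z => exact Nat.le_mul_of_pos_right _ hB
  | reg r =>
    have := hs.1 r
    simp only [Expr.cost, Expr.costWeight]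
    omega
  | get A e h =>
    have h1 := len_eval_le hB hs e
    have h2 := hs.2 A (e.eval s).toNat
    simp only [Expr.cost, Expr.costWeight]
    nlinarith
  | add e₁ e₂ h₁ h₂ | sub e₁ e₂ h₁ h₂ | mul e₁ e₂ h₁ h₂ | div e₁ e₂ h₁ h₂ =>
    have h3 := len_eval_le hB hs e₁
    have h4 := len_eval_le hB hs e₂
    simp only [Expr.cost, Expr.costWeight]
    nlinarith

end Weight

/-- The running time of a program all of whose loops take at most `M` rounds is at most this number
times the length of the memory contents. -/
def Prog.timeWeight (M : ℕ) : Prog → ℕ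
  | .skip => 1
  | .set _ e => e.costWeight + (1 + e.valueWeight)
  | .put _ i e => i.costWeight + e.costWeight + (1 + i.valueWeight + e.valueWeight)
  | .seq p q => p.timeWeight M + q.timeWeight M
  | .ite e p q => e.costWeight + 1 + (p.timeWeight M + q.timeWeight M)
  | .loop e p => (M + 1) * (e.costWeight + 1 + p.timeWeight M)

/-- Only a loop contributes a factor M + 1, so for a fixed program the degree is governed by its
syntax. Degrees are added where a maximum would do, which keeps one combination rule for all
constructors. -/
theorem Prog.exists_timeWeight_le (P : Prog) :
    ∃ c d : ℕ, ∀ M, P.timeWeight M ≤ c * (M + 1) ^ d := by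
  have key : ∀ {c₁ d₁ c₂ d₂ M x y : ℕ}, x ≤ c₁ * (M + 1) ^ d₁ → y ≤ c₂ * (M + 1) ^ d₂ →
      x + y ≤ (c₁ + c₂) * (M + 1) ^ (d₁ + d₂) := by
    intro c₁ d₁ c₂ d₂ M x y hx hy
    have h1 : (M + 1) ^ d₁ ≤ (M + 1) ^ (d₁ + d₂) := Nat.pow_le_pow_right (by omega) (by omega)
    have h2 : (M + 1) ^ d₂ ≤ (M + 1) ^ (d₁ + d₂) := Nat.pow_le_pow_right (by omega) (by omega)
    nlinarith [Nat.mul_le_mul_left c₁ h1, Nat.mul_le_mul_left c₂ h2]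
  induction P with
  | skip => exact ⟨1, 0, by simp [timeWeight]⟩
  | set r e => exact ⟨_, 0, fun M => by simp [timeWeight]; rfl⟩
  | put A i e => exact ⟨_, 0, fun M => by simp [timeWeight]; rfl⟩
  | seq p q hp hq =>
    obtain ⟨c₁, d₁, h₁⟩ := hp
    obtain ⟨c₂, d₂, h₂⟩ := hq
    exact ⟨_, _, fun M => key (h₁ M) (h₂ M)⟩
  | ite e p q hp hq =>
    obtain ⟨c₁, d₁, h₁⟩ := hp
    obtain ⟨c₂, d₂, h₂⟩ := hq
    exact ⟨e.costWeight + 1 + (c₁ + c₂), 0 + (d₁ + d₂),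
      fun M => key (by simp) (key (h₁ M) (h₂ M))⟩
  | loop e p hp =>
    obtain ⟨c, d, h⟩ := hp
    refine ⟨e.costWeight + 1 + c, 0 + d + 1, fun M => ?_⟩
    have := key (c₁ := e.costWeight + 1) (d₁ := 0) (x := e.costWeight + 1) (by simp) (h M)
    rw [timeWeight, pow_succ]
    nlinarith

/-- The program `p` halts when started in `s`, the final state satisfies `Q`, the memory contents
have at most `B` digits in the end, and the time is at most `p.timeWeight M * B`. -/
def Runs (B M : ℕ) (p : Prog) (s : State) (Q : State → Prop) : Prop :=
  ∃ s' n, Exec p s s' n ∧ n ≤ p.timeWeight M * B ∧ s'.Bounded B ∧ Q s'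

/-- Sequential composition of a list of programs. -/
def Prog.block : List Prog → Prog
  | [] => .skip
  | p :: ps => .seq p (block ps)

/-! ### Hoare-style rules that carry the time and memory bounds. -/

section Rules

variable {B M : ℕ} {s : State} {Q : State → Prop}

theorem Runs.nil (hB : 0 < B) (hs : s.Bounded B) (h : Q s) : Runs B M (.block []) s Q :=
  ⟨s, 1, .skip s, by simpa [Prog.block, Prog.timeWeight] using Nat.succ_le_of_lt hB, hs, h⟩

theorem Runs.cons {p : Prog} {ps : List Prog} {R : State → Prop} (hp : Runs B M p s R)
    (h : ∀ s', s'.Bounded B → R s' → Runs B M (.block ps) s' Q) :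
    Runs B M (.block (p :: ps)) s Q := by
  obtain ⟨s₁, m, e₁, hm, b₁, r₁⟩ := hp
  obtain ⟨s₂, n, e₂, hn, b₂, r₂⟩ := h s₁ b₁ r₁
  refine ⟨s₂, m + n, e₁.seq e₂, ?_, b₂, r₂⟩
  rw [Prog.block, Prog.timeWeight, add_mul]
  omega

/-- Only the stored value needs a bound by `B` digits; intermediate values inside `e` are covered by
`cost_le` and `len_eval_le`. Naming the value `z` lets its length be bounded as a mathematical
quantity. -/
theorem Runs.set (hB : 0 < B) (hs : s.Bounded B) {r : ℕ} {e : Expr} {ps : List Prog} {z : ℤ}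
    (he : e.eval s = z) (hz : len z ≤ B)
    (h : (s.setReg r z).Bounded B → Runs B M (.block ps) (s.setReg r z) Q) :
    Runs B M (.block (.set r e :: ps)) s Q := by
  subst he
  refine Runs.cons (R := fun s' => s' = s.setReg r (e.eval s))
    ⟨_, _, .set s r e, ?_, hs.setReg hz, rfl⟩ ?_
  · have h1 := cost_le hB hs e
    have h2 := len_eval_le hB hs e
    rw [Prog.timeWeight]
    nlinarith
  · rintro s' hs' rfl
    exact h hs'

theorem Runs.put (hB : 0 < B) (hs : s.Bounded B) {A j : ℕ} {i e : Expr} {ps : List Prog} {z : ℤ}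
    (hi : i.eval s = j) (he : e.eval s = z) (hz : len z ≤ B)
    (h : (s.setArr A j z).Bounded B → Runs B M (.block ps) (s.setArr A j z) Q) :
    Runs B M (.block (.put A i e :: ps)) s Q := by
  subst he
  obtain rfl : j = (i.eval s).toNat := by simp [hi]
  refine Runs.cons (R := fun s' => s' = s.setArr A (i.eval s).toNat (e.eval s))
    ⟨_, _, .put s A i e, ?_, hs.setArr hz, rfl⟩ ?_
  · have h1 := cost_le hB hs e
    have h2 := len_eval_le hB hs e
    have h3 := cost_le hB hs i
    have h4 := len_eval_le hB hs i
    rw [Prog.timeWeight]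
    nlinarith
  · rintro s' hs' rfl
    exact h hs'

/-- A loop that takes `n` rounds, with the invariant `inv j` after `j` rounds. -/
theorem Runs.loop (hB : 0 < B) {e : Expr} {p : Prog} {n : ℕ} (hn : n ≤ M)
    (inv : ℕ → State → Prop)
    (he : ∀ j s, j ≤ n → inv j s → e.eval s = (n : ℤ) - j)
    (hp : ∀ j s, j < n → s.Bounded B → inv j s → Runs B M p s (inv (j + 1)))
    (hs : s.Bounded B) (h0 : inv 0 s) : Runs B M (.loop e p) s (inv n) := by
  -- Induction on the number `i` of rounds still to come; the test is evaluated `i + 1` times.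
  have key : ∀ i j s, j + i = n → s.Bounded B → inv j s →
      ∃ s' m, Exec (.loop e p) s s' m ∧
        m ≤ (i + 1) * (e.costWeight + 1 + p.timeWeight M) * B ∧ s'.Bounded B ∧ inv n s' := by
    intro i
    induction i with
    | zero =>
      intro j s hj hs hi
      obtain rfl : j = n := hj
      refine ⟨s, _, .loopDone ?_, ?_, hs, hi⟩
      · rw [he _ s le_rfl hi]; simp
      · have := cost_le hB hs e
        nlinarith
    | succ i ih =>
      intro j s hj hs hi
      obtain ⟨s₁, m, e₁, hm, b₁, r₁⟩ := hp j s (by omega) hs hi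
      obtain ⟨s₂, k, e₂, hk, b₂, r₂⟩ := ih (j + 1) s₁ (by omega) b₁ r₁
      refine ⟨s₂, _, .loopStep ?_ e₁ e₂, ?_, b₂, r₂⟩
      · rw [he j s (by omega) hi]; omega
      · have := cost_le hB hs e
        nlinarith
  obtain ⟨s', m, e', hm, b', r'⟩ := key n 0 s (by omega) hs h0
  refine ⟨s', m, e', hm.trans ?_, b', r'⟩
  rw [Prog.timeWeight]
  gcongr

end Rules

end RAM

/-! ## Separable convex knapsack problems -/

/-- The first component is the largest positive value of `f` on `0, …, n - 1` and the second its
first position; both are `0` if there is no positive value. -/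
def scanMax (f : ℕ → ℤ) : ℕ → ℤ × ℕ
  | 0 => (0, 0)
  | j + 1 => if 0 < f j - (scanMax f j).1 then (f j, j) else scanMax f j

theorem scanMax_nonneg (f : ℕ → ℤ) (n : ℕ) : 0 ≤ (scanMax f n).1 := by
  induction n with
  | zero => exact le_rfl
  | succ n ih => rw [scanMax]; split_ifs <;> omega

theorem le_scanMax (f : ℕ → ℤ) {n j : ℕ} (hj : j < n) : f j ≤ (scanMax f n).1 := by
  induction n with
  | zero => omega
  | succ n ih =>
    rw [scanMax]
    rcases Nat.lt_succ_iff_lt_or_eq.1 hj with h | rfl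
    · have := ih h
      split_ifs <;> omega
    · split_ifs <;> omega

theorem scanMax_le (f : ℕ → ℤ) {n : ℕ} {b : ℤ} (hb : 0 ≤ b) (h : ∀ j < n, f j ≤ b) :
    (scanMax f n).1 ≤ b := by
  induction n with
  | zero => exact hb
  | succ n ih =>
    rw [scanMax]
    split_ifs
    · exact h n (by omega)
    · exact ih fun j hj => h j (by omega)

theorem scanMax_snd_le (f : ℕ → ℤ) (n : ℕ) : (scanMax f n).2 ≤ n - 1 := by
  induction n with
  | zero => exact le_rfl
  | succ n ih => rw [scanMax]; split_ifs <;> omega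

theorem scanMax_eq (f : ℕ → ℤ) {n : ℕ} (h : 0 < (scanMax f n).1) :
    f (scanMax f n).2 = (scanMax f n).1 := by
  induction n with
  | zero => exact absurd h (lt_irrefl _)
  | succ n ih =>
    rw [scanMax] at h ⊢
    split_ifs at h ⊢ with h'
    · rfl
    · exact ih h

/-- The last position among `0, …, n - 1` where `f` is positive, or `0` if there is none. -/
def lastPos (f : ℕ → ℤ) : ℕ → ℕ
  | 0 => 0
  | q + 1 => if 0 < f q then q else lastPos f q

theorem lastPos_le (f : ℕ → ℤ) (n : ℕ) : lastPos f n ≤ n - 1 := by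
  induction n with
  | zero => exact le_rfl
  | succ n ih => rw [lastPos]; split_ifs <;> omega

theorem le_lastPos (f : ℕ → ℤ) {n q : ℕ} (hq : q < n) (h : 0 < f q) :
    q ≤ lastPos f n ∧ 0 < f (lastPos f n) := by
  induction n with
  | zero => omega
  | succ n ih =>
    rw [lastPos]
    split_ifs with h'
    · exact ⟨by omega, h'⟩
    · rcases Nat.lt_succ_iff_lt_or_eq.1 hq with h₁ | rfl
      · exact ih h₁
      · exact absurd h h'

/-- A knapsack problem with `T` items and budget `G`. Putting the amount `u ≤ δ t` of the item `t`
gains the maximum of `α t * u - max 0 (-z t)` and `β * u - max 0 (z t)`. Gains are rounded down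
to multiples of `LB / N`. -/
structure Knapsack where
  T : ℕ
  N : ℕ
  LB : ℤ
  G : ℤ
  β : ℤ
  α : ℕ → ℤ
  z : ℕ → ℤ
  δ : ℕ → ℤ

namespace Knapsack

variable (K : Knapsack)

/-- The gain of the amount `u` of the item `t`. -/
noncomputable def gain (t : ℕ) (u : ℝ) : ℝ :=
  max (K.α t * u - (max 0 (-K.z t) : ℤ)) (K.β * u - (max 0 (K.z t) : ℤ))

/-- The amount `u` for which `a * u - p` equals `j * LB / N`. -/
def amount (a p : ℤ) (j : ℕ) : ℤ :=
  if 0 < a then (j * K.LB + K.N * p) / (K.N * a) else K.G + 1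

/-- The least amount of the item `t` that gains `j * LB / N`, or a value over the budget. -/
def weight (t j : ℕ) : ℤ :=
  if (0 : ℤ) < j then
    if 0 < K.δ t + 1 -
        min (K.amount (K.α t) (max 0 (-K.z t)) j) (K.amount K.β (max 0 (K.z t)) j) then
      min (K.amount (K.α t) (max 0 (-K.z t)) j) (K.amount K.β (max 0 (K.z t)) j)
    else K.G + 1
  else 0

/-- One plus the largest budget left when the first `t` items gain `q * LB / N` after rounding, and
`0` if that exceeds the budget. -/
def value : ℕ → ℕ → ℤ
  | 0, q => if q = 0 then K.G + 1 else 0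
  | t + 1, q => (scanMax (fun j => value t (q - j) - K.weight t j) (q + 1)).1

/-- The rounded gain of item `t` in a best choice for the first `t + 1` items. -/
def choice (t q : ℕ) : ℕ := (scanMax (fun j => K.value t (q - j) - K.weight t j) (q + 1)).2

/-- The largest rounded gain that is possible within the budget. -/
def best : ℕ := lastPos (K.value K.T) (K.T * K.N + 1)

/-- The rounded gain that is left after the last `i` items. -/
def back : ℕ → ℕ
  | 0 => K.best
  | i + 1 => back i - K.choice (K.T - (i + 1)) (back i)

/-- The amount of the item `t` in the solution found. -/
def solution (t : ℕ) : ℤ :=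
  K.value t (K.back (K.T - t)) - K.value (t + 1) (K.back (K.T - (t + 1)))

/-- Sign conditions, and divisibility conditions under which all amounts are integers. -/
structure Regular : Prop where
  N_pos : 0 < K.N
  LB_nonneg : 0 ≤ K.LB
  G_nonneg : 0 ≤ K.G
  α_nonneg : ∀ t, 0 ≤ K.α t
  β_nonneg : 0 ≤ K.β
  δ_nonneg : ∀ t, 0 ≤ K.δ t
  α_dvd : ∀ t, 0 < K.α t → K.N * K.α t ∣ K.LB ∧ K.N * K.α t ∣ K.z t
  β_dvd : ∀ t, 0 < K.β → K.N * K.β ∣ K.LB ∧ K.N * K.β ∣ K.z t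

theorem value_nonneg (hG : 0 ≤ K.G) (t q : ℕ) : 0 ≤ K.value t q := by
  cases t with
  | zero => rw [value]; split_ifs <;> omega
  | succ t => exact scanMax_nonneg _ _

theorem choice_le (t q : ℕ) : K.choice t q ≤ q := scanMax_snd_le _ _

theorem back_le (i : ℕ) : K.back i ≤ K.T * K.N := by
  induction i with
  | zero => exact lastPos_le _ _
  | succ i ih => exact (Nat.sub_le _ _).trans ih

theorem dvd_max_zero {a b : ℤ} (h : a ∣ b) : a ∣ max 0 b := by
  rcases max_choice 0 b with h' | h' <;> rw [h']
  exacts [dvd_zero _, h]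

/-- At least one of the two offsets, the positive and the negative part of `z t`, vanishes. -/
theorem gain_zero (t : ℕ) : 0 ≤ K.gain t 0 := by
  rcases le_total 0 (K.z t) with h | h
  · exact le_max_of_le_left (by simp [h])
  · exact le_max_of_le_right (by simp [h])

theorem value_best_pos (h : ∃ q ≤ K.T * K.N, 0 < K.value K.T q) : 0 < K.value K.T K.best := by
  obtain ⟨q, hq, h⟩ := h
  exact (le_lastPos _ (Nat.lt_succ_of_le hq) h).2

variable {K} (hK : K.Regular)

include hK

theorem amount_nonneg {a p : ℤ} (hp : 0 ≤ p) (j : ℕ) : 0 ≤ K.amount a p j := by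
  have := hK.G_nonneg
  have := hK.LB_nonneg
  rw [amount]
  split_ifs
  · positivity
  · omega

theorem weight_nonneg (t j : ℕ) : 0 ≤ K.weight t j := by
  have := hK.G_nonneg
  have h1 := amount_nonneg hK (a := K.α t) (le_max_left 0 (-K.z t)) j
  have h2 := amount_nonneg hK (a := K.β) (le_max_left 0 (K.z t)) j
  rw [weight]
  split_ifs <;> omega

theorem weight_le_max (t j : ℕ) : K.weight t j ≤ max (K.δ t) (K.G + 1) := by
  have := hK.G_nonneg
  rw [weight]
  split_ifs <;> omega

theorem value_le (t q : ℕ) : K.value t q ≤ K.G + 1 := by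
  have hG := hK.G_nonneg
  induction t generalizing q with
  | zero => rw [value]; split_ifs <;> omega
  | succ t ih =>
    refine scanMax_le _ (by omega) fun j _ => ?_
    have h1 := ih (q - j)
    have h2 := weight_nonneg hK t j
    omega

/-- Divisibility makes the integer division exact, so the integer `amount` is the true breakpoint
even against arbitrary real `u`. This permits comparison with all real scenarios. -/
theorem amount_le_iff {a p : ℤ} (ha : 0 < a) (h₁ : K.N * a ∣ K.LB) (h₂ : K.N * a ∣ p) (j : ℕ)
    (u : ℝ) : (K.amount a p j : ℝ) ≤ u ↔ (j * K.LB : ℝ) ≤ K.N * (a * u - p) := by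
  have hN : (0 : ℝ) < K.N := by exact_mod_cast hK.N_pos
  have ha' : (0 : ℝ) < a := by exact_mod_cast ha
  have hd : K.N * a ∣ j * K.LB + K.N * p := dvd_add (h₁.mul_left _) (h₂.mul_left _)
  rw [amount, if_pos ha, Int.cast_div hd (by push_cast; positivity), div_le_iff₀]
  · push_cast
    constructor <;> intro h <;> linarith
  · push_cast
    positivity

theorem gain_mono (t : ℕ) {u v : ℝ} (h : u ≤ v) : K.gain t u ≤ K.gain t v := by
  have h1 : (0 : ℝ) ≤ K.α t := by exact_mod_cast hK.α_nonneg t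
  have h2 : (0 : ℝ) ≤ K.β := by exact_mod_cast hK.β_nonneg
  unfold gain
  gcongr

theorem gain_nonneg (t : ℕ) {u : ℝ} (h : 0 ≤ u) : 0 ≤ K.gain t u :=
  (K.gain_zero t).trans (gain_mono hK t h)

/-- The amount `weight t j` is admissible and gains at least `j * LB / N`. -/
theorem weight_spec {t j : ℕ} (h : K.weight t j ≤ K.G) :
    K.weight t j ≤ K.δ t ∧ (j * K.LB : ℝ) ≤ K.N * K.gain t (K.weight t j) := by
  have hN : (0 : ℝ) ≤ K.N := Nat.cast_nonneg _
  have key : ∀ a p : ℤ, (0 < a → K.N * a ∣ K.LB ∧ K.N * a ∣ p) → K.amount a p j ≤ K.G →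
      (j * K.LB : ℝ) ≤ K.N * (a * K.amount a p j - p) := by
    intro a p hd hG
    by_cases ha : 0 < a
    · exact (amount_le_iff hK ha (hd ha).1 (hd ha).2 j _).1 le_rfl
    · rw [amount, if_neg ha] at hG
      omega
  rw [weight] at h ⊢
  split_ifs at h ⊢ with hj hδ
  · refine ⟨by omega, ?_⟩
    rcases min_choice (K.amount (K.α t) (max 0 (-K.z t)) j)
      (K.amount K.β (max 0 (K.z t)) j) with hm | hm <;> rw [hm] at h ⊢
    · refine (key _ _ (fun ha => ?_) h).trans
        (mul_le_mul_of_nonneg_left (le_max_left _ _) hN)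
      exact ⟨(hK.α_dvd t ha).1, dvd_max_zero ((hK.α_dvd t ha).2.neg_right)⟩
    · refine (key _ _ (fun ha => ?_) h).trans
        (mul_le_mul_of_nonneg_left (le_max_right _ _) hN)
      exact ⟨(hK.β_dvd t ha).1, dvd_max_zero (hK.β_dvd t ha).2⟩
  · omega
  · obtain rfl : j = 0 := by omega
    refine ⟨hK.δ_nonneg t, ?_⟩
    have := K.gain_zero t
    simp only [Nat.cast_zero, zero_mul, Int.cast_zero]
    positivity

/-- Every admissible amount that gains at least `j * LB / N` is at least `weight t j`. -/
theorem weight_le (hLB : 0 < K.LB) {t j : ℕ} {u : ℝ} (h0 : 0 ≤ u) (hδ : u ≤ K.δ t)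
    (h : (j * K.LB : ℝ) ≤ K.N * K.gain t u) : (K.weight t j : ℝ) ≤ u := by
  have hN : (0 : ℝ) < K.N := by exact_mod_cast hK.N_pos
  have hLB' : (0 : ℝ) < K.LB := by exact_mod_cast hLB
  by_cases hj : 0 < (j : ℤ)
  swap
  · rw [weight, if_neg hj]
    simpa using h0
  have key : ∀ a p : ℤ, 0 ≤ a → 0 ≤ p → (0 < a → K.N * a ∣ K.LB ∧ K.N * a ∣ p) →
      (j * K.LB : ℝ) ≤ K.N * (a * u - p) → (K.amount a p j : ℝ) ≤ u := by
    intro a p ha hp hd hu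
    rcases ha.lt_or_eq with ha | rfl
    · exact (amount_le_iff hK ha (hd ha).1 (hd ha).2 j u).2 hu
    -- A branch of slope 0 never exceeds 0, while `j * LB` is positive; this is where `LB > 0` is
    -- needed, since `amount` is the sentinel `G + 1` here.
    · have h1 : (0 : ℝ) ≤ p := by exact_mod_cast hp
      have h2 : (0 : ℝ) < j := by exact_mod_cast hj
      have h3 := mul_pos h2 hLB'
      simp only [Int.cast_zero, zero_mul, zero_sub] at hu
      nlinarith [mul_nonneg hN.le h1]
  have hm : ((min (K.amount (K.α t) (max 0 (-K.z t)) j)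
      (K.amount K.β (max 0 (K.z t)) j) : ℤ) : ℝ) ≤ u := by
    rw [Int.cast_min, min_le_iff]
    rw [gain, mul_max_of_nonneg _ _ hN.le, le_max_iff] at h
    refine h.imp (key _ _ (hK.α_nonneg t) (le_max_left _ _) fun ha => ?_)
      (key _ _ hK.β_nonneg (le_max_left _ _) fun ha => ?_)
    · exact ⟨(hK.α_dvd t ha).1, dvd_max_zero ((hK.α_dvd t ha).2.neg_right)⟩
    · exact ⟨(hK.β_dvd t ha).1, dvd_max_zero (hK.β_dvd t ha).2⟩
  have hm' := hm.trans hδ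
  rw [Int.cast_le] at hm'
  rw [weight, if_pos hj, if_pos (by omega)]
  exact hm

/-- The table dominates every real solution: replacing each `u i` by the least amount reaching the
level `j i` spends no more budget, and the recursion maximises over all such choices of levels. -/
theorem le_value (hLB : 0 < K.LB) {u : ℕ → ℝ} {j : ℕ → ℕ} (t : ℕ)
    (h : ∀ i < t, 0 ≤ u i ∧ u i ≤ K.δ i ∧ (j i * K.LB : ℝ) ≤ K.N * K.gain i (u i)) :
    K.G + 1 - ∑ i ∈ Finset.range t, u i ≤ K.value t (∑ i ∈ Finset.range t, j i) := by
  induction t with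
  | zero => simp [value]
  | succ t ih =>
    have h1 := ih fun i hi => h i (by omega)
    obtain ⟨h2, h3, h4⟩ := h t (by omega)
    have h5 := weight_le hK hLB h2 h3 h4
    have h6 := le_scanMax
      (fun i => K.value t (∑ i ∈ Finset.range (t + 1), j i - i) - K.weight t i)
      (n := ∑ i ∈ Finset.range (t + 1), j i + 1) (j := j t)
      (by rw [Finset.sum_range_succ]; omega)
    rw [← value] at h6
    simp only [Finset.sum_range_succ, Nat.add_sub_cancel] at h6 ⊢
    rify at h6
    linarith

/-- Level 0 has weight 0, so doing nothing keeps the whole budget. Hence the search for `best`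
always meets a positive entry. -/
theorem value_zero_zero_pos (t : ℕ) : 0 < K.value t 0 := by
  have := hK.G_nonneg
  induction t with
  | zero => rw [value]; simp only [if_true]; omega
  | succ t ih =>
    have := le_scanMax (fun i => K.value t (0 - i) - K.weight t i) (n := 1) one_pos
    rw [← zero_add 1, ← value] at this
    simp only [weight] at this
    simp at this
    omega

/-- Backtracking never leaves the feasible entries: a positive entry is attained at its `choice`,
and its predecessor is larger by a nonnegative weight. -/
theorem value_back_pos (i : ℕ) (hi : i ≤ K.T) : 0 < K.value (K.T - i) (K.back i) := by
  induction i with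
  | zero => exact K.value_best_pos ⟨0, by omega, value_zero_zero_pos hK _⟩
  | succ i ih =>
    have h1 := ih (by omega)
    rw [show K.T - i = K.T - (i + 1) + 1 by omega, value] at h1
    have h2 := scanMax_eq _ h1
    rw [← choice] at h2
    have h3 := weight_nonneg hK (K.T - (i + 1)) (K.choice (K.T - (i + 1)) (K.back i))
    rw [back]
    omega

/-- Along the backtracking path consecutive table entries differ exactly by the weight of the chosen
level. The machine can therefore read the amount off the table without computing a weight again. -/
theorem solution_eq {t : ℕ} (ht : t < K.T) :
    K.solution t = K.weight t (K.back (K.T - (t + 1)) - K.back (K.T - t)) ∧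
      K.back (K.T - t) ≤ K.back (K.T - (t + 1)) := by
  have h1 := value_back_pos hK (K.T - (t + 1)) (by omega)
  rw [show K.T - (K.T - (t + 1)) = t + 1 by omega] at h1
  have h2 : K.back (K.T - t) =
      K.back (K.T - (t + 1)) - K.choice t (K.back (K.T - (t + 1))) := by
    rw [show K.T - t = K.T - (t + 1) + 1 by omega, back,
      show K.T - (K.T - (t + 1) + 1) = t by omega]
  have h3 := K.choice_le t (K.back (K.T - (t + 1)))
  rw [solution, h2]
  rw [value] at h1
  have h4 := scanMax_eq _ h1
  rw [← choice] at h4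
  rw [value, show K.back (K.T - (t + 1)) -
    (K.back (K.T - (t + 1)) - K.choice t (K.back (K.T - (t + 1)))) =
      K.choice t (K.back (K.T - (t + 1))) by omega]
  omega

theorem solution_nonneg {t : ℕ} (ht : t < K.T) : 0 ≤ K.solution t := by
  rw [(solution_eq hK ht).1]
  exact weight_nonneg hK _ _

theorem solution_le_G {t : ℕ} (ht : t < K.T) : K.solution t ≤ K.G := by
  have h1 := value_back_pos hK (K.T - (t + 1)) (by omega)
  have h2 := value_le hK t (K.back (K.T - t))
  rw [show K.T - (K.T - (t + 1)) = t + 1 by omega] at h1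
  rw [solution]
  omega

theorem solution_le {t : ℕ} (ht : t < K.T) : K.solution t ≤ K.δ t := by
  have h := solution_le_G hK ht
  rw [(solution_eq hK ht).1] at h ⊢
  exact (weight_spec hK h).1

/-- The sum telescopes to a difference of two table entries, the first at most `G + 1` and the last
at least 1. -/
theorem sum_solution_le : ∑ t ∈ Finset.range K.T, K.solution t ≤ K.G := by
  have h0 := value_back_pos hK 0 (by omega)
  have h := Finset.sum_range_sub' (fun t => K.value t (K.back (K.T - t))) K.T
  simp only [Nat.sub_self] at h
  have h1 := value_le hK 0 (K.back (K.T - 0))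
  simp only [solution]
  rw [Nat.sub_zero] at *
  omega

theorem best_le_gain : (K.best * K.LB : ℝ) ≤
    K.N * ∑ t ∈ Finset.range K.T, K.gain t (K.solution t) := by
  have h0 := value_back_pos hK K.T le_rfl
  -- In row 0 only column 0 is positive, so the whole level `best` has been distributed and the
  -- level differences telescope to it.
  have hb : K.back K.T = 0 := by
    rw [Nat.sub_self, value] at h0
    by_contra h
    rw [if_neg h] at h0
    exact lt_irrefl _ h0
  have h := Finset.sum_range_sub (fun t => (K.back (K.T - t) : ℝ)) K.T
  rw [Nat.sub_self, Nat.sub_zero, hb, Nat.cast_zero, sub_zero, back] at h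
  rw [← h, Finset.sum_mul, Finset.mul_sum]
  refine Finset.sum_le_sum fun t ht => ?_
  rw [Finset.mem_range] at ht
  obtain ⟨h1, h2⟩ := solution_eq hK ht
  have h3 := solution_le_G hK ht
  rw [h1] at h3 ⊢
  rw [← Nat.cast_sub h2]
  exact (weight_spec hK h3).2

/-- A feasible choice of amounts gains at most `best * LB / N`, up to rounding. -/
theorem floor_gain_le_best (hLB : 0 < K.LB)
    (hmax : ∀ t < K.T, K.gain t (min (K.δ t) K.G : ℤ) ≤ K.LB) {u : ℕ → ℝ}
    (hu : ∀ t < K.T, 0 ≤ u t ∧ u t ≤ K.δ t)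
    (hG : ∑ t ∈ Finset.range K.T, u t ≤ K.G) :
    ∑ t ∈ Finset.range K.T, ⌊K.N * K.gain t (u t) / K.LB⌋₊ ≤ K.best := by
  have hLB' : (0 : ℝ) < K.LB := by exact_mod_cast hLB
  have hN : (0 : ℝ) < K.N := by exact_mod_cast hK.N_pos
  refine (le_lastPos _ (Nat.lt_succ_of_le ?_) ?_).1
  -- The total level stays inside the table: each gain is at most `LB`, so each rounded level is at
  -- most `N`.
  · rw [← Finset.card_range K.T, ← smul_eq_mul (Finset.card _),
      Finset.card_range]
    conv_rhs => rw [← Finset.card_range K.T]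
    refine Finset.sum_le_card_nsmul _ _ _ fun t ht => Nat.floor_le_of_le ?_
    have ht' := Finset.mem_range.1 ht
    rw [div_le_iff₀ hLB']
    refine mul_le_mul_of_nonneg_left ((gain_mono hK t ?_).trans (hmax t ht')) hN.le
    rw [Int.cast_min]
    refine le_min (hu t ht').2 (le_trans ?_ hG)
    exact Finset.single_le_sum (fun i hi => (hu i (Finset.mem_range.1 hi)).1) ht
  -- Feasibility makes `G + 1 - ∑ u` at least 1, so the entry is positive; this is the purpose of
  -- the shift by one in `value`.
  · have h := le_value hK hLB (u := u) (j := fun t => ⌊K.N * K.gain t (u t) / K.LB⌋₊) K.T ?_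
    · rw [← Int.cast_pos (R := ℝ)]
      linarith
    · intro i hi
      refine ⟨(hu i hi).1, (hu i hi).2, ?_⟩
      rw [← le_div_iff₀ hLB']
      have := gain_nonneg hK i (hu i hi).1
      exact Nat.floor_le (by positivity)

/-- The solution found is optimal up to the factor `1 + 1 / k`. -/
theorem gain_le_solution {k : ℕ} (hk : 0 < k) (hN : k * K.T ≤ K.N)
    (hmax : ∀ t < K.T, K.gain t (min (K.δ t) K.G : ℤ) ≤ K.LB)
    (hLB : K.LB = 0 ∨ ∃ t < K.T, K.gain t (min (K.δ t) K.G : ℤ) = K.LB) {u : ℕ → ℝ}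
    (hu : ∀ t < K.T, 0 ≤ u t ∧ u t ≤ K.δ t)
    (hG : ∑ t ∈ Finset.range K.T, u t ≤ K.G) :
    ∑ t ∈ Finset.range K.T, K.gain t (u t) ≤
      (1 + 1 / k) * ∑ t ∈ Finset.range K.T, K.gain t (K.solution t) := by
  have hN0 : (0 : ℝ) < K.N := by exact_mod_cast hK.N_pos
  have hk0 : (0 : ℝ) < k := by exact_mod_cast hk
  have hS : 0 ≤ ∑ t ∈ Finset.range K.T, K.gain t (K.solution t) :=
    Finset.sum_nonneg fun t ht => gain_nonneg hK t
      (by exact_mod_cast solution_nonneg hK (Finset.mem_range.1 ht))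
  have hle : ∀ t < K.T, K.gain t (u t) ≤ K.LB := fun t ht => by
    refine (gain_mono hK t ?_).trans (hmax t ht)
    rw [Int.cast_min]
    refine le_min (hu t ht).2 (le_trans ?_ hG)
    exact Finset.single_le_sum (fun i hi => (hu i (Finset.mem_range.1 hi)).1)
      (Finset.mem_range.2 ht)
  rcases hK.LB_nonneg.lt_or_eq with hpos | h0
  swap
  · refine le_trans (Finset.sum_nonpos fun t ht => ?_) (by positivity)
    simpa [← h0] using hle t (Finset.mem_range.1 ht)
  have hLB' : (0 : ℝ) < K.LB := by exact_mod_cast hpos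
  have hbest := best_le_gain hK
  -- Spending on the one item that attains `LB` already reaches level `N`.
  have h1 : (K.N : ℝ) ≤ K.best := by
    obtain ⟨t, ht, hgt⟩ := hLB.resolve_left hpos.ne'
    have h := floor_gain_le_best hK hpos hmax
      (u := fun i => if i = t then ((min (K.δ t) K.G : ℤ) : ℝ) else 0) ?_ ?_
    · refine le_trans ?_ (Nat.cast_le.2 h)
      refine le_trans ?_ (Nat.cast_le.2 (Finset.single_le_sum (fun i _ => Nat.zero_le _)
        (Finset.mem_range.2 ht)))
      rw [if_pos rfl, hgt, mul_div_assoc, div_self hLB'.ne', mul_one, Nat.floor_natCast]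
    · intro i _
      have h1 := hK.δ_nonneg i
      have h2 := hK.G_nonneg
      split_ifs with hi
      · subst hi
        exact ⟨by exact_mod_cast le_min h1 h2, by exact_mod_cast min_le_left _ _⟩
      · exact ⟨le_rfl, by exact_mod_cast h1⟩
    · rw [Finset.sum_ite_eq' _ t, if_pos (Finset.mem_range.2 ht)]
      exact_mod_cast min_le_right _ _
  -- Rounding down costs less than one level per item, hence the summand `T`.
  have h2 : K.N * ∑ t ∈ Finset.range K.T, K.gain t (u t) ≤ (K.best + K.T) * K.LB := by
    have h := floor_gain_le_best hK hpos hmax hu hG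
    have h' : ∑ t ∈ Finset.range K.T, K.N * K.gain t (u t) / K.LB ≤
        ∑ t ∈ Finset.range K.T, ((⌊K.N * K.gain t (u t) / K.LB⌋₊ : ℝ) + 1) :=
      Finset.sum_le_sum fun t _ => (Nat.lt_floor_add_one _).le
    rw [Finset.sum_add_distrib, ← Nat.cast_sum, ← Finset.sum_div, ← Finset.mul_sum,
      div_le_iff₀ hLB'] at h'
    refine h'.trans ?_
    have : ((∑ t ∈ Finset.range K.T, ⌊K.N * K.gain t (u t) / K.LB⌋₊ : ℕ) : ℝ) ≤ K.best :=
      Nat.cast_le.2 h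
    simp only [Finset.sum_const, Finset.card_range, nsmul_eq_mul, mul_one]
    gcongr
  have hN' : (k * K.T : ℝ) ≤ K.N := by exact_mod_cast hN
  set S := ∑ t ∈ Finset.range K.T, K.gain t (K.solution t)
  have h3 : (K.LB : ℝ) ≤ S := by
    have := mul_le_mul_of_nonneg_right h1 hLB'.le
    exact le_of_mul_le_mul_left (this.trans hbest) hN0
  -- The rounding loss is absorbed by combining `T ≤ N / k` with `LB ≤ S`.
  have h4 : (K.T * K.LB : ℝ) ≤ K.N * (1 / k * S) := by
    have : (K.T : ℝ) ≤ K.N * (1 / k) := by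
      rw [mul_one_div, le_div_iff₀ hk0]
      linarith
    rw [← mul_assoc]
    exact mul_le_mul this h3 hLB'.le (by positivity)
  refine le_of_mul_le_mul_left (h2.trans ?_) hN0
  rw [add_mul, add_mul, one_mul, mul_add]
  exact add_le_add hbest h4

end Knapsack

/-! ## Solving separable convex knapsack problems on the machine

Registers: `0` number of items, `15` resolution `N`, `16` scale `L`, `17` budget, `18` width of the
tables, `19` unit of the gains `LB`, `20` slope `β`, from `21` on working registers.
Arrays: `0` and `1` numerators and denominators of the output for the amounts `0`, `2` maximal
deviations, `7` slopes `α`, `8` offsets `z`, `9` table of values, `10` table of choices. -/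

namespace Knapsack

open RAM

variable {K : Knapsack} {L : ℤ} {num den : ℕ → ℤ}

/-- Number of columns of the tables. -/
def width (K : Knapsack) : ℕ := K.T * K.N + 1

/-- The memory contains the data of the knapsack problem. -/
structure Loaded (K : Knapsack) (L : ℤ) (num den : ℕ → ℤ) (s : State) : Prop where
  T : s.reg 0 = K.T
  N : s.reg 15 = K.N
  scale : s.reg 16 = L
  G : s.reg 17 = K.G
  width : s.reg 18 = K.width
  LB : s.reg 19 = K.LB
  β : s.reg 20 = K.β
  num : s.arr 0 = num
  den : s.arr 1 = den
  δ : ∀ t < K.T, s.arr 2 t * L = K.δ t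
  α : ∀ t < K.T, s.arr 7 t = K.α t
  z : ∀ t < K.T, s.arr 8 t = K.z t

theorem Loaded.setReg {s : State} (h : Loaded K L num den s) {r : ℕ} (hr : 21 ≤ r) (x : ℤ) :
    Loaded K L num den (s.setReg r x) := by
  obtain ⟨h1, h2, h3, h4, h5, h6, h7, h8, h9, h10, h11, h12⟩ := h
  constructor
  case num => exact h8
  case den => exact h9
  case δ => exact h10
  case α => exact h11
  case z => exact h12
  all_goals rw [reg_setReg, if_neg (by omega)]; assumption

theorem Loaded.setArr {s : State} (h : Loaded K L num den s) {A : ℕ}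
    (hA : A = 5 ∨ A = 6 ∨ 9 ≤ A) (i : ℕ) (x : ℤ) : Loaded K L num den (s.setArr A i x) := by
  have key : ∀ A' t, A' ≠ A → (s.setArr A i x).arr A' t = s.arr A' t := fun A' t h' => by
    rw [arr_setArr, if_neg (fun h => h' h.1)]
  constructor
  case num => funext t; rw [key 0 t (by omega), h.num]
  case den => funext t; rw [key 1 t (by omega), h.den]
  case δ => intro t ht; rw [key 2 t (by omega), h.δ t ht]
  case α => intro t ht; rw [key 7 t (by omega), h.α t ht]
  case z => intro t ht; rw [key 8 t (by omega), h.z t ht]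
  exacts [h.T, h.N, h.scale, h.G, h.width, h.LB, h.β]

/-- The first `t` rows of the tables (apart from the initial one) are filled, and the next row up
to the column `n`. -/
def Filled (K : Knapsack) (t n : ℕ) (s : State) : Prop :=
  (∀ t' q, q < K.width → (t' ≤ t ∨ t' = t + 1 ∧ q < n) →
    s.arr 9 (t' * K.width + q) = K.value t' q) ∧
  (∀ t' q, q < K.width → (t' < t ∨ t' = t ∧ q < n) →
    s.arr 10 (t' * K.width + q) = K.choice t' q)

theorem Filled.setArr {t n : ℕ} {s : State} (h : Filled K t n s) {A : ℕ} (hA : A < 9) (i : ℕ)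
    (x : ℤ) : Filled K t n (s.setArr A i x) := by
  constructor
  · intro t' q hq ht
    rw [arr_setArr, if_neg (by omega), h.1 t' q hq ht]
  · intro t' q hq ht
    rw [arr_setArr, if_neg (by omega), h.2 t' q hq ht]

theorem Filled.next {t : ℕ} {s : State} (h : Filled K t K.width s) : Filled K (t + 1) 0 s :=
  ⟨fun t' q hq ht => h.1 t' q hq (by omega), fun t' q hq ht => h.2 t' q hq (by omega)⟩

/-- The tables are stored row by row in one-dimensional arrays; distinct cells must have distinct
addresses so that writing one preserves the others. -/
theorem index_inj {w t t' q q' : ℕ} (hq : q < w) (hq' : q' < w)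
    (h : t * w + q = t' * w + q') : t = t' ∧ q = q' := by
  have h1 : (t * w + q) / w = t := by
    rw [mul_comm, Nat.mul_add_div (by omega), Nat.div_eq_of_lt hq, add_zero]
  have h2 : (t' * w + q') / w = t' := by
    rw [mul_comm, Nat.mul_add_div (by omega), Nat.div_eq_of_lt hq', add_zero]
  obtain rfl : t = t' := by rw [← h1, h, h2]
  exact ⟨rfl, by omega⟩

theorem Filled.put {t n : ℕ} {s : State} (h : Filled K t n s) (hn : n < K.width) :
    Filled K t (n + 1) ((s.setArr 9 ((t + 1) * K.width + n) (K.value (t + 1) n)).setArr 10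
      (t * K.width + n) (K.choice t n)) := by
  constructor
  · intro t' q hq ht
    rw [arr_setArr, if_neg (by omega), arr_setArr]
    split_ifs with hi
    · obtain ⟨rfl, rfl⟩ := index_inj hq hn hi.2
      rfl
    · refine h.1 t' q hq ?_
      rcases ht with ht | ⟨rfl, ht⟩
      · exact .inl ht
      · refine .inr ⟨rfl, lt_of_le_of_ne (Nat.lt_succ_iff.1 ht) ?_⟩
        rintro rfl
        exact hi ⟨rfl, rfl⟩
  · intro t' q hq ht
    rw [arr_setArr]
    split_ifs with hi
    · obtain ⟨rfl, rfl⟩ := index_inj hq hn hi.2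
      rfl
    · rw [arr_setArr, if_neg (by omega)]
      refine h.2 t' q hq ?_
      rcases ht with ht | ⟨rfl, ht⟩
      · exact .inl ht
      · refine .inr ⟨rfl, lt_of_le_of_ne (Nat.lt_succ_iff.1 ht) ?_⟩
        rintro rfl
        exact hi ⟨rfl, rfl⟩

/-- Bounds on the memory contents: numbers up to `Z` have at most `B` digits. -/
structure Fits (K : Knapsack) (L : ℤ) (num den : ℕ → ℤ) (B M : ℕ) (Z : ℤ) : Prop where
  B_pos : 0 < B
  len_le : ∀ z : ℤ, |z| ≤ Z → len z ≤ B
  G_le : K.G + 1 ≤ Z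
  δ_le : ∀ t < K.T, K.δ t ≤ Z
  index_le : ((K.T + 1) * K.width : ℤ) ≤ Z
  num_le : ∀ t < K.T, |num t| * |L| + K.G * |den t| ≤ Z
  den_le : ∀ t < K.T, |den t * L| ≤ Z
  T_le : K.T ≤ M
  width_le : K.width ≤ M

variable {B M : ℕ} {Z : ℤ}

theorem Fits.len_natCast_le (hF : Fits K L num den B M Z) {n : ℕ} (h : n ≤ K.width) :
    len n ≤ B := by
  refine hF.len_le n ?_
  rw [Nat.abs_cast]
  have h1 := hF.index_le
  have h2 : (n : ℤ) ≤ K.width := by exact_mod_cast h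
  have h3 : (0 : ℤ) ≤ K.T := Int.natCast_nonneg _
  nlinarith

theorem Fits.len_natCast_le' (hF : Fits K L num den B M Z) {n : ℕ} (h : n ≤ K.T) :
    len n ≤ B := by
  refine hF.len_le n ?_
  rw [Nat.abs_cast]
  have h1 := hF.index_le
  have h2 : (n : ℤ) ≤ K.T := by exact_mod_cast h
  have h3 : (1 : ℤ) ≤ K.width := by exact_mod_cast Nat.succ_pos _
  nlinarith

theorem eval_get_natCast {s : State} {A i : ℕ} {e : Expr} (h : e.eval s = i) :
    (Expr.get A e).eval s = s.arr A i := by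
  rw [eval_get, h, Int.toNat_natCast]

/-- Computes an amount. -/
def amountExpr (a p : Expr) : Expr :=
  a.cond ((.reg 23 * .reg 19 + .reg 15 * p) / (.reg 15 * a)) (.reg 17 + .lit 1)

/-- Computes the smaller of the two amounts for the two slopes. -/
def minAmountExpr : Expr :=
  (amountExpr (.get 7 (.reg 21)) (Expr.max (.lit 0) (.lit 0 - .get 8 (.reg 21)))).min
    (amountExpr (.reg 20) (Expr.max (.lit 0) (.get 8 (.reg 21))))

/-- Computes a weight. -/
def weightExpr : Expr :=
  (Expr.reg 23).cond
    ((.get 2 (.reg 21) * .reg 16 + .lit 1 - minAmountExpr).cond minAmountExpr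
      (.reg 17 + .lit 1))
    (.lit 0)

theorem eval_weightExpr {s : State} (h : Loaded K L num den s) {t j : ℕ} (ht : t < K.T)
    (h21 : s.reg 21 = t) (h23 : s.reg 23 = j) : weightExpr.eval s = K.weight t j := by
  simp only [weightExpr, minAmountExpr, amountExpr, eval_cond, eval_min, eval_max, eval_add,
    eval_sub, eval_mul, eval_div, eval_reg, eval_lit, eval_get, h21, h23, Int.toNat_natCast,
    h.N, h.scale, h.G, h.LB, h.β, h.δ t ht, h.α t ht, h.z t ht, zero_sub, weight, amount]
  rfl

/-- One round of the computation of a table entry. -/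
def scanStep : Prog := .block [
  .set 26 (.get 9 (.reg 21 * .reg 18 + (.reg 22 - .reg 23)) - weightExpr),
  .set 25 ((Expr.reg 26 - .reg 24).cond (.reg 23) (.reg 25)),
  .set 24 ((Expr.reg 26 - .reg 24).cond (.reg 26) (.reg 24)),
  .set 23 (.reg 23 + .lit 1)]

/-- Computation of a row of the tables. -/
def fillStep : Prog := .block [
  .set 23 (.lit 0),
  .set 24 (.lit 0),
  .set 25 (.lit 0),
  .loop (.reg 22 + .lit 1 - .reg 23) scanStep,
  .put 9 ((.reg 21 + .lit 1) * .reg 18 + .reg 22) (.reg 24),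
  .put 10 (.reg 21 * .reg 18 + .reg 22) (.reg 25),
  .set 22 (.reg 22 + .lit 1)]

/-- Computation of the tables. -/
def fill : Prog := .block [
  .set 21 (.lit 0),
  .put 9 (.lit 0) (.reg 17 + .lit 1),
  .loop (.reg 0 - .reg 21) (.block [
    .set 22 (.lit 0),
    .loop (.reg 18 - .reg 22) fillStep,
    .set 21 (.reg 21 + .lit 1)])]

/-- Search for the best rounded gain. -/
def search : Prog := .block [
  .set 22 (.lit 0),
  .set 27 (.lit 0),
  .loop (.reg 18 - .reg 22) (.block [
    .set 27 ((Expr.get 9 (.reg 0 * .reg 18 + .reg 22)).cond (.reg 22) (.reg 27)),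
    .set 22 (.reg 22 + .lit 1)])]

/-- One round of the computation of the solution. -/
def backStep : Prog := .block [
  .set 21 (.reg 21 - .lit 1),
  .set 24 (.reg 27 - .get 10 (.reg 21 * .reg 18 + .reg 27)),
  .set 26 (.get 9 (.reg 21 * .reg 18 + .reg 24) -
    .get 9 ((.reg 21 + .lit 1) * .reg 18 + .reg 27)),
  .set 27 (.reg 24),
  .put 5 (.reg 21) (.get 0 (.reg 21) * .reg 16 +
    Expr.cond
      ((.reg 20 * .reg 26 - Expr.max (.lit 0) (.get 8 (.reg 21))) -
        (.get 7 (.reg 21) * .reg 26 - Expr.max (.lit 0) (.lit 0 - .get 8 (.reg 21))))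
      (.reg 26) (.lit 0 - .reg 26) * .get 1 (.reg 21)),
  .put 6 (.reg 21) (.get 1 (.reg 21) * .reg 16)]

/-- Computation of the solution from the tables. -/
def backtrack : Prog := .block [
  .set 21 (.reg 0),
  .loop (.reg 21) backStep]

/-- The amount with which the item `t` enters the output, with its sign. -/
def signedSolution (K : Knapsack) (t : ℕ) : ℤ :=
  if 0 < (K.β * K.solution t - max 0 (K.z t)) -
      (K.α t * K.solution t - max 0 (-K.z t)) then
    K.solution t
  else -K.solution t

/-! ### Verification of the table computation, the search and the backtracking. -/

section

variable (hF : Fits K L num den B M Z) (hK : K.Regular)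

include hF hK

theorem runs_scanStep {t q j : ℕ} (ht : t < K.T) (hq : q < K.width) (hj : j < q + 1)
    {f : ℕ → ℤ} (hf : f = fun i => K.value t (q - i) - K.weight t i)
    {s : State} (hs : s.Bounded B) (h : Loaded K L num den s ∧ Filled K t q s ∧ s.reg 21 = t ∧
      s.reg 22 = q ∧ s.reg 23 = j ∧ s.reg 24 = (scanMax f j).1 ∧ s.reg 25 = (scanMax f j).2) :
    Runs B M scanStep s fun s => Loaded K L num den s ∧ Filled K t q s ∧ s.reg 21 = t ∧
      s.reg 22 = q ∧ s.reg 23 = (j + 1 : ℕ) ∧ s.reg 24 = (scanMax f (j + 1)).1 ∧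
      s.reg 25 = (scanMax f (j + 1)).2 := by
  obtain ⟨h, hT, h21, h22, h23, h24, h25⟩ := h
  have hG := hK.G_nonneg
  have hfle : ∀ i, f i ≤ K.G + 1 := fun i => by
    have h1 := value_le hK t (q - i)
    have h2 := weight_nonneg hK t i
    rw [hf]
    dsimp only
    omega
  have hz : ∀ n, len (scanMax f n).1 ≤ B := fun n => by
    have h1 := scanMax_nonneg f n
    have h2 := scanMax_le f (n := n) (by omega) fun i _ => hfle i
    refine hF.len_le _ (abs_le.2 ⟨?_, ?_⟩) <;> linarith [hF.G_le]
  have hget : (Expr.get 9 (.reg 21 * .reg 18 + (.reg 22 - .reg 23))).eval s =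
      K.value t (q - j) := by
    rw [eval_get_natCast (i := t * K.width + (q - j))]
    · exact hT.1 _ _ (by omega) (.inl le_rfl)
    · simp only [eval_add, eval_mul, eval_sub, eval_reg, h21, h22, h23, h.width]
      rw [← Nat.cast_sub (by omega)]
      push_cast
      rfl
  have hfj := hfle j
  refine Runs.set hF.B_pos hs (z := f j) ?_ ?_ fun hs => ?_
  · rw [eval_sub, eval_weightExpr h ht h21 h23, hget, hf]
  · have h1 := K.value_nonneg hG t (q - j)
    have h2 := weight_le_max hK t j
    have h3 := hF.δ_le t ht
    have h4 := hF.G_le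
    refine hF.len_le _ (abs_le.2 ⟨?_, by omega⟩)
    rw [hf]
    dsimp only
    omega
  -- The position in register 25 is updated before the maximum in register 24, because both updates
  -- test against the old maximum.
  refine Runs.set hF.B_pos hs (z := (scanMax f (j + 1)).2) ?_ ?_ fun hs => ?_
  · simp only [eval_cond, eval_sub, eval_reg, reg_setReg, h23, h24, h25, scanMax]
    simp only [if_true, Nat.reduceEqDiff, if_false]
    split_ifs <;> rfl
  · have := scanMax_snd_le f (j + 1)
    exact hF.len_natCast_le (by omega)
  refine Runs.set hF.B_pos hs (z := (scanMax f (j + 1)).1) ?_ (hz _) fun hs => ?_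
  · simp only [eval_cond, eval_sub, eval_reg, reg_setReg, h24, scanMax]
    simp only [if_true, Nat.reduceEqDiff, if_false]
    split_ifs <;> rfl
  refine Runs.set hF.B_pos hs (z := (j + 1 : ℕ)) ?_ (hF.len_natCast_le (by omega)) fun hs => ?_
  · simp [h23]
  refine Runs.nil hF.B_pos hs ?_
  refine ⟨(((h.setReg ?_ _).setReg ?_ _).setReg ?_ _).setReg ?_ _, hT, ?_⟩
  all_goals simp [h21, h22]

theorem runs_fillStep {t q : ℕ} (ht : t < K.T) (hq : q < K.width)
    {s : State} (hs : s.Bounded B) (h : Loaded K L num den s ∧ Filled K t q s ∧ s.reg 21 = t ∧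
      s.reg 22 = q) :
    Runs B M fillStep s fun s => Loaded K L num den s ∧ Filled K t (q + 1) s ∧ s.reg 21 = t ∧
      s.reg 22 = (q + 1 : ℕ) := by
  obtain ⟨h, hT, h21, h22⟩ := h
  have hG := hK.G_nonneg
  have h0 : len 0 ≤ B := hF.len_natCast_le (Nat.zero_le _)
  refine Runs.set hF.B_pos hs rfl h0 fun hs => ?_
  refine Runs.set hF.B_pos hs rfl h0 fun hs => ?_
  refine Runs.set hF.B_pos hs rfl h0 fun hs => ?_
  refine Runs.cons (Runs.loop hF.B_pos (n := q + 1) (Nat.le_trans hq hF.width_le)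
    (fun j s => Loaded K L num den s ∧ Filled K t q s ∧ s.reg 21 = t ∧
      s.reg 22 = q ∧ s.reg 23 = j ∧
      s.reg 24 = (scanMax (fun i => K.value t (q - i) - K.weight t i) j).1 ∧
      s.reg 25 = (scanMax (fun i => K.value t (q - i) - K.weight t i) j).2)
    ?_ (fun j s hj hs hi => runs_scanStep hF hK ht hq hj rfl hs hi) hs ?_) ?_
  · rintro j s - ⟨-, -, -, h22, h23, -⟩
    simp [h22, h23]
  · refine ⟨((h.setReg ?_ _).setReg ?_ _).setReg ?_ _, hT, ?_⟩
    all_goals simp [h21, h22, scanMax]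
  · rintro s hs ⟨h, hT, h21, h22, -, h24, h25⟩
    rw [← value] at h24
    rw [← choice] at h25
    refine Runs.put hF.B_pos hs (j := (t + 1) * K.width + q) (z := K.value (t + 1) q) ?_
      (by simp [h24]) ?_ fun hs => ?_
    · simp [h21, h22, h.width]
    · have h1 := K.value_nonneg hG (t + 1) q
      have h2 := value_le hK (t + 1) q
      refine hF.len_le _ (abs_le.2 ⟨?_, ?_⟩) <;> linarith [hF.G_le]
    refine Runs.put hF.B_pos hs (j := t * K.width + q) (z := K.choice t q) ?_
      (by simp [h25]) ?_ fun hs => ?_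
    · simp [h21, h22, h.width]
    · exact hF.len_natCast_le ((K.choice_le t q).trans hq.le)
    refine Runs.set hF.B_pos hs (z := (q + 1 : ℕ)) ?_ (hF.len_natCast_le hq) fun hs => ?_
    · simp [h22]
    refine Runs.nil hF.B_pos hs ⟨((h.setArr ?_ _ _).setArr ?_ _ _).setReg ?_ _,
      hT.put hq, ?_⟩
    all_goals simp [h21]

theorem runs_fill {s : State} (hs : s.Bounded B) (h : Loaded K L num den s)
    (h9 : ∀ i, s.arr 9 i = 0) :
    Runs B M fill s fun s => Loaded K L num den s ∧ Filled K K.T 0 s := by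
  have hG := hK.G_nonneg
  have h0 : len 0 ≤ B := hF.len_natCast_le (Nat.zero_le _)
  refine Runs.set hF.B_pos hs rfl h0 fun hs => ?_
  refine Runs.put hF.B_pos hs (j := 0) (z := K.G + 1) (by simp) (by simp [h.G]) ?_ fun hs => ?_
  · exact hF.len_le _ (abs_le.2 ⟨by linarith [hF.G_le], hF.G_le⟩)
  refine Runs.cons (Runs.loop hF.B_pos (n := K.T) hF.T_le
    (fun t s => Loaded K L num den s ∧ Filled K t 0 s ∧ s.reg 21 = t) ?_ ?_ hs ?_)
    fun s hs h => Runs.nil hF.B_pos hs ⟨h.1, h.2.1⟩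
  · rintro t s - ⟨h, -, h21⟩
    simp [h.T, h21]
  · rintro t s ht hs ⟨h, hT, h21⟩
    refine Runs.set hF.B_pos hs rfl h0 fun hs => ?_
    refine Runs.cons (Runs.loop hF.B_pos (n := K.width) hF.width_le
      (fun q s => Loaded K L num den s ∧ Filled K t q s ∧ s.reg 21 = t ∧ s.reg 22 = q)
      ?_ (fun q s hq hs hi => runs_fillStep hF hK ht hq hs hi) hs ?_) ?_
    · rintro q s - ⟨h, -, -, h22⟩
      simp [h.width, h22]
    · exact ⟨h.setReg (by norm_num) _, hT, by simp [h21], by simp⟩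
    · rintro s hs ⟨h, hT, h21, h22⟩
      refine Runs.set hF.B_pos hs (z := (t + 1 : ℕ)) (by simp [h21]) (hF.len_natCast_le' ht)
        fun hs => Runs.nil hF.B_pos hs ⟨h.setReg (by norm_num) _, hT.next, by simp⟩
  · refine ⟨(h.setReg (by norm_num) _).setArr (by norm_num) _ _, ⟨?_, ?_⟩, by simp⟩
    · intro t q hq ht
      obtain rfl : t = 0 := by omega
      -- Only column 0 of row 0 has been written; the other entries are correct because the array is
      -- initially zero.
      simp [value, h9]
    · intro t q hq ht
      omega

omit hK in
theorem runs_search {s : State} (hs : s.Bounded B)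
    (h : Loaded K L num den s ∧ Filled K K.T 0 s) :
    Runs B M search s fun s => Loaded K L num den s ∧ Filled K K.T 0 s ∧ s.reg 27 = K.best := by
  obtain ⟨h, hT⟩ := h
  have h0 : len 0 ≤ B := hF.len_natCast_le (Nat.zero_le _)
  refine Runs.set hF.B_pos hs rfl h0 fun hs => ?_
  refine Runs.set hF.B_pos hs rfl h0 fun hs => ?_
  refine Runs.cons (Runs.loop hF.B_pos (n := K.width) hF.width_le
    (fun q s => Loaded K L num den s ∧ Filled K K.T 0 s ∧ s.reg 22 = q ∧
      s.reg 27 = lastPos (K.value K.T) q) ?_ ?_ hs ?_)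
    fun s hs h => Runs.nil hF.B_pos hs ⟨h.1, h.2.1, h.2.2.2⟩
  · rintro q s - ⟨h, -, h22, -⟩
    simp [h.width, h22]
  · rintro q s hq hs ⟨h, hT, h22, h27⟩
    refine Runs.set hF.B_pos hs (z := lastPos (K.value K.T) (q + 1)) ?_ ?_ fun hs => ?_
    · rw [eval_cond, eval_get_natCast (i := K.T * K.width + q) (by simp [h.T, h.width, h22]),
        hT.1 _ _ hq (.inl le_rfl), eval_reg, eval_reg, h22, h27, lastPos]
      split_ifs <;> rfl
    · have := lastPos_le (K.value K.T) (q + 1)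
      exact hF.len_natCast_le (by omega)
    refine Runs.set hF.B_pos hs (z := (q + 1 : ℕ)) (by simp [h22]) (hF.len_natCast_le hq)
      fun hs => Runs.nil hF.B_pos hs
        ⟨(h.setReg (by norm_num) _).setReg (by norm_num) _, hT, by simp, by simp⟩
  · exact ⟨(h.setReg (by norm_num) _).setReg (by norm_num) _, hT, by simp, by simp [lastPos]⟩

theorem runs_backStep {i : ℕ} (hi : i < K.T) {s : State} (hs : s.Bounded B)
    (h : Loaded K L num den s ∧ Filled K K.T 0 s ∧ s.reg 21 = (K.T : ℤ) - i ∧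
      s.reg 27 = K.back i ∧ ∀ t < K.T, K.T - i ≤ t →
        s.arr 5 t = num t * L + K.signedSolution t * den t ∧ s.arr 6 t = den t * L) :
    Runs B M backStep s fun s => Loaded K L num den s ∧ Filled K K.T 0 s ∧
      s.reg 21 = (K.T : ℤ) - (i + 1 : ℕ) ∧
      s.reg 27 = K.back (i + 1) ∧ ∀ t < K.T, K.T - (i + 1) ≤ t →
        s.arr 5 t = num t * L + K.signedSolution t * den t ∧ s.arr 6 t = den t * L := by
  obtain ⟨h, hT, h21, h27, ho⟩ := h
  obtain ⟨t, ht⟩ : ∃ t, t = K.T - (i + 1) := ⟨_, rfl⟩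
  have htT : t < K.T := by omega
  -- Items are visited from the last to the first: round `i` treats item `T - (i + 1)`.
  have ht1 : (K.T : ℤ) - i - 1 = t := by omega
  have ht2 : K.T - (t + 1) = i := by omega
  have ht3 : K.T - t = i + 1 := by omega
  have hb : ∀ i, K.back i < K.width := fun i => Nat.lt_succ_of_le (K.back_le i)
  have hsol0 := solution_nonneg hK htT
  have hsolG := solution_le_G hK htT
  refine Runs.set hF.B_pos hs (z := t) (by simp [h21, ht1]) (hF.len_natCast_le' htT.le)
    fun hs => ?_
  refine Runs.set hF.B_pos hs (z := K.back (i + 1)) ?_ (hF.len_natCast_le (hb _).le)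
    fun hs => ?_
  · rw [eval_sub, eval_get_natCast (i := t * K.width + K.back i) (by simp [h27, h.width]),
      arr_setReg, hT.2 _ _ (hb i) (.inl htT), eval_reg]
    simp only [reg_setReg, Nat.reduceEqDiff, if_false, h27]
    rw [back, ← ht, Nat.cast_sub (K.choice_le _ _)]
  refine Runs.set hF.B_pos hs (z := K.solution t) ?_ ?_ fun hs => ?_
  · rw [eval_sub, eval_get_natCast (i := t * K.width + K.back (i + 1)) (by simp [h.width]),
      eval_get_natCast (i := (t + 1) * K.width + K.back i) (by simp [h.width, h27])]
    simp only [arr_setReg]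
    rw [hT.1 _ _ (hb _) (.inl htT.le), hT.1 _ _ (hb _) (.inl htT), solution, ht2, ht3]
  · exact hF.len_le _ (abs_le.2 ⟨by linarith [hF.G_le], by linarith [hF.G_le]⟩)
  refine Runs.set hF.B_pos hs (z := K.back (i + 1)) (by simp) (hF.len_natCast_le (hb _).le)
    fun hs => ?_
  refine Runs.put hF.B_pos hs (j := t) (z := num t * L + K.signedSolution t * den t)
    (by simp) ?_ ?_ fun hs => ?_
  · simp only [eval_add, eval_mul, eval_sub, eval_cond, eval_max, eval_get, eval_reg, eval_lit,
      arr_setReg, reg_setReg, Nat.reduceEqDiff, if_true, if_false,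
      Int.toNat_natCast, h.num, h.den, h.scale, h.β, h.α t htT, h.z t htT, zero_sub,
      signedSolution]
  · refine hF.len_le _ (le_trans ?_ (hF.num_le t htT))
    refine (abs_add_le _ _).trans ?_
    rw [abs_mul, abs_mul]
    have : |K.signedSolution t| ≤ K.G := by
      rw [signedSolution]
      split_ifs
      · rwa [abs_of_nonneg hsol0]
      · rwa [abs_neg, abs_of_nonneg hsol0]
    gcongr
  refine Runs.put hF.B_pos hs (j := t) (z := den t * L) (by simp) ?_ (hF.len_le _ (hF.den_le t htT))
    fun hs => ?_
  · simp [h.den, h.scale]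
  refine Runs.nil hF.B_pos hs ⟨?_, ?_, ?_, ?_, ?_⟩
  · refine Loaded.setArr (Loaded.setArr ?_ (by norm_num) _ _) (by norm_num) _ _
    exact (((h.setReg (by norm_num) _).setReg (by norm_num) _).setReg (by norm_num) _).setReg
      (by norm_num) _
  · exact Filled.setArr (Filled.setArr hT (by norm_num) _ _) (by norm_num) _ _
  · simp
    omega
  · simp
  · intro t' ht' hle
    simp only [arr_setArr, arr_setReg]
    by_cases h' : t' = t
    · simp [h']
    · have := ho t' ht' (by omega)
      simp [h', this]

theorem runs_backtrack {s : State} (hs : s.Bounded B)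
    (h : Loaded K L num den s ∧ Filled K K.T 0 s ∧ s.reg 27 = K.best) :
    Runs B M backtrack s fun s => ∀ t < K.T,
      s.arr 5 t = num t * L + K.signedSolution t * den t ∧ s.arr 6 t = den t * L := by
  obtain ⟨h, hT, h27⟩ := h
  refine Runs.set hF.B_pos hs (z := K.T) (by simp [h.T]) (hF.len_natCast_le' le_rfl) fun hs => ?_
  refine Runs.cons (Runs.loop hF.B_pos (n := K.T) hF.T_le
    (fun i s => Loaded K L num den s ∧ Filled K K.T 0 s ∧ s.reg 21 = (K.T : ℤ) - i ∧
      s.reg 27 = K.back i ∧ ∀ t < K.T, K.T - i ≤ t →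
        s.arr 5 t = num t * L + K.signedSolution t * den t ∧ s.arr 6 t = den t * L)
    ?_ (fun i s hi hs h => runs_backStep hF hK hi hs h) hs ?_) ?_
  · rintro j s - ⟨-, -, h21, -⟩
    simp [h21]
  · refine ⟨h.setReg (by norm_num) _, hT, by simp, by simp [h27, back], ?_⟩
    intro t ht ht'
    omega
  · rintro s hs ⟨-, -, -, -, h⟩
    exact Runs.nil hF.B_pos hs fun t ht => h t ht (by omega)

/-- Solving the knapsack problem. -/
theorem runs_solve {s : State} (hs : s.Bounded B) (h : Loaded K L num den s)
    (h9 : ∀ i, s.arr 9 i = 0) :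
    Runs B M (.block [fill, search, backtrack]) s fun s => ∀ t < K.T,
      s.arr 5 t = num t * L + K.signedSolution t * den t ∧ s.arr 6 t = den t * L :=
  Runs.cons (runs_fill hF hK hs h h9) fun _ hs h =>
    Runs.cons (runs_search hF hs h) fun _ hs h =>
      Runs.cons (runs_backtrack hF hK hs h) fun _ hs h => Runs.nil hF.B_pos hs h

end

end Knapsack

/-! ## The knapsack problem of an instance -/

namespace AdvInstance

open RAM

variable (I : AdvInstance) (k : ℕ)

/-- Numerators of the nominal demands. -/
def demandNum : ℕ → ℤ := toArr fun t => (I.Dhat t).num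

/-- Denominators of the nominal demands. -/
def demandDen : ℕ → ℤ := toArr fun t => ((I.Dhat t).den : ℤ)

/-- Maximal deviations. -/
def deviation : ℕ → ℤ := toArr fun t => (I.Δ t : ℤ)

/-- Numerators of the production amounts. -/
def prodNum : ℕ → ℤ := toArr fun t => (I.x t).num

/-- Denominators of the production amounts. -/
def prodDen : ℕ → ℤ := toArr fun t => ((I.x t).den : ℤ)

/-- A common denominator of the demands and production amounts of the first `n` periods. -/
def denomUpTo (n : ℕ) : ℤ := ∏ t ∈ Finset.range n, I.demandDen t * I.prodDen t

/-- A common denominator of all demands and production amounts. -/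
def denom : ℤ := I.denomUpTo I.T

/-- Scaled inventory cost. -/
def slopeI : ℤ := I.cI.num * (I.cB.den * I.bP.den)

/-- Scaled sum of the inventory cost and the selling price. -/
def slopeLast : ℤ := I.slopeI + I.bP.num * (I.cI.den * I.cB.den)

/-- Scaled backordering cost. -/
def slopeB : ℤ := I.cB.num * (I.cI.den * I.bP.den)

/-- The number of units into which the largest single gain is divided. -/
def resolution : ℕ := k * I.T + 1

/-- A scale for the changes of the demands that makes all relevant changes integral. -/
def scale : ℤ :=
  I.resolution k * I.denom * max 1 I.slopeI * max 1 I.slopeLast * max 1 I.slopeB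

/-- Scaled rate at which the cost of period `t` increases for small demands. -/
def slope (t : ℕ) : ℤ := if 0 < (I.T : ℤ) - t - 1 then I.slopeI else I.slopeLast

/-- Scaled cumulative production in the first `n` periods. -/
def scaledProd (n : ℕ) : ℤ := ∑ t ∈ Finset.range n, I.prodNum t * (I.denom / I.prodDen t)

/-- Scaled difference of cumulative production and nominal demand. -/
def excess (t : ℕ) : ℤ := I.scaledProd (t + 1) - I.demandNum t * (I.denom / I.demandDen t)

/-- Difference of the two scaled costs that determine the cost of period `t`. -/
def offset (t : ℕ) : ℤ := (I.slope t + I.slopeB) * I.excess t * I.scale k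

/-- The scaled gain of the largest feasible change of the demand of period `t` alone. -/
def singleGain (t : ℕ) : ℤ :=
  max (I.denom * I.slope t * min (I.deviation t * I.scale k) (I.Γ * I.scale k) -
      max 0 (-I.offset k t))
    (I.denom * I.slopeB * min (I.deviation t * I.scale k) (I.Γ * I.scale k) -
      max 0 (I.offset k t))

/-- The largest scaled gain of a change of the demand in one of the first `n` periods. -/
def maxSingleGain : ℕ → ℤ
  | 0 => 0
  | n + 1 => max (maxSingleGain n) (I.singleGain k n)

/-- The knapsack problem of distributing the budget over the periods. -/
def knapsack : Knapsack where
  T := I.T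
  N := I.resolution k
  LB := I.maxSingleGain k I.T
  G := I.Γ * I.scale k
  β := I.denom * I.slopeB
  α t := I.denom * I.slope t
  z := I.offset k
  δ t := I.deviation t * I.scale k

variable {I k}

/-! ### Positivity and divisibility of the scaled data. -/

theorem toArr_lt {T : ℕ} {v : Fin T → ℤ} {t : ℕ} (h : t < T) : toArr v t = v ⟨t, h⟩ := dif_pos h

theorem demandDen_pos {t : ℕ} (h : t < I.T) : 0 < I.demandDen t := by
  rw [demandDen, toArr_lt h]
  exact_mod_cast (I.Dhat _).den_pos

theorem prodDen_pos {t : ℕ} (h : t < I.T) : 0 < I.prodDen t := by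
  rw [prodDen, toArr_lt h]
  exact_mod_cast (I.x _).den_pos

theorem denomUpTo_pos {n : ℕ} (h : n ≤ I.T) : 0 < I.denomUpTo n :=
  Finset.prod_pos fun _ ht => by
    have := (Finset.mem_range.1 ht).trans_le h
    exact mul_pos (demandDen_pos this) (prodDen_pos this)

theorem denom_pos : 0 < I.denom := denomUpTo_pos le_rfl

theorem demandDen_dvd {t : ℕ} (h : t < I.T) : I.demandDen t ∣ I.denom :=
  (Dvd.intro _ rfl).trans (Finset.dvd_prod_of_mem _ (Finset.mem_range.2 h))

theorem prodDen_dvd {t : ℕ} (h : t < I.T) : I.prodDen t ∣ I.denom :=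
  (Dvd.intro_left _ rfl).trans (Finset.dvd_prod_of_mem _ (Finset.mem_range.2 h))

theorem scale_pos : 0 < I.scale k := by
  have h1 : 0 < max 1 I.slopeI := lt_max_of_lt_left one_pos
  have h2 : 0 < max 1 I.slopeLast := lt_max_of_lt_left one_pos
  have h3 : 0 < max 1 I.slopeB := lt_max_of_lt_left one_pos
  have h4 : 0 < I.denom := denom_pos
  have h5 : 0 < (I.resolution k : ℤ) := by exact_mod_cast Nat.succ_pos _
  rw [scale]
  positivity

theorem deviation_nonneg (t : ℕ) : 0 ≤ I.deviation t := by
  rw [deviation, toArr]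
  split_ifs
  exacts [Int.natCast_nonneg _, le_rfl]

theorem maxSingleGain_nonneg (n : ℕ) : 0 ≤ I.maxSingleGain k n := by
  induction n with
  | zero => exact le_rfl
  | succ n ih => exact le_max_of_le_left ih

theorem singleGain_le {n t : ℕ} (h : t < n) : I.singleGain k t ≤ I.maxSingleGain k n := by
  induction n with
  | zero => omega
  | succ n ih =>
    rcases Nat.lt_succ_iff_lt_or_eq.1 h with h | rfl
    exacts [le_max_of_le_left (ih h), le_max_right _ _]

/-- Attainment makes this number a lower bound for the optimal gain, not only an upper bound for
single gains. -/
theorem maxSingleGain_eq (n : ℕ) :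
    I.maxSingleGain k n = 0 ∨ ∃ t < n, I.singleGain k t = I.maxSingleGain k n := by
  induction n with
  | zero => exact .inl rfl
  | succ n ih =>
    rw [maxSingleGain]
    rcases max_choice (I.maxSingleGain k n) (I.singleGain k n) with h | h <;> rw [h]
    · exact ih.imp id fun ⟨t, ht, h⟩ => ⟨t, ht.trans (Nat.lt_succ_self _), h⟩
    · exact .inr ⟨n, Nat.lt_succ_self _, rfl⟩

theorem dvd_max {a b c : ℤ} (hb : a ∣ b) (hc : a ∣ c) : a ∣ max b c := by
  rcases max_choice b c with h | h <;> rwa [h]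

theorem dvd_min {a b c : ℤ} (hb : a ∣ b) (hc : a ∣ c) : a ∣ min b c := by
  rcases min_choice b c with h | h <;> rwa [h]

/-- Maximal amounts, budget and offsets all carry the factor `scale`, and sums, maxima and minima
preserve it. Together with `dvd_scale` this yields the divisibility required by `Regular`. -/
theorem scale_dvd_maxSingleGain (n : ℕ) : I.scale k ∣ I.maxSingleGain k n := by
  induction n with
  | zero => exact dvd_zero _
  | succ n ih =>
    have h1 : I.scale k ∣ min (I.deviation n * I.scale k) (I.Γ * I.scale k) :=
      dvd_min (Dvd.intro_left _ rfl) (Dvd.intro_left _ rfl)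
    have h2 : I.scale k ∣ I.offset k n := Dvd.intro_left _ rfl
    exact dvd_max ih (dvd_max
      (dvd_sub (h1.mul_left _) (dvd_max (dvd_zero _) h2.neg_right))
      (dvd_sub (h1.mul_left _) (dvd_max (dvd_zero _) h2)))

theorem slope_eq (t : ℕ) : I.slope t = I.slopeI ∨ I.slope t = I.slopeLast := by
  rw [slope]
  split_ifs
  exacts [.inl rfl, .inr rfl]

/-- A positive slope equals its factor `max 1 m` in `scale`. The maximum with 1 keeps the scale
nonzero when some slope vanishes. -/
theorem dvd_scale {m : ℤ} (hm : 0 < m) (h : m = I.slopeI ∨ m = I.slopeLast ∨ m = I.slopeB) :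
    I.resolution k * (I.denom * m) ∣ I.scale k := by
  have : m = max 1 m := (max_eq_right hm).symm
  rw [this, scale]
  rcases h with rfl | rfl | rfl
  · exact ⟨max 1 I.slopeLast * max 1 I.slopeB, by ring⟩
  · exact ⟨max 1 I.slopeI * max 1 I.slopeB, by ring⟩
  · exact ⟨max 1 I.slopeI * max 1 I.slopeLast, by ring⟩

namespace Admissible

variable (hI : I.Admissible)

include hI

theorem slopeI_nonneg : 0 ≤ I.slopeI := by
  have := Rat.num_nonneg.2 hI.cI_nonneg
  rw [slopeI]
  positivity

theorem slopeB_nonneg : 0 ≤ I.slopeB := by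
  have := Rat.num_nonneg.2 hI.cB_nonneg
  rw [slopeB]
  positivity

theorem slopeLast_nonneg : 0 ≤ I.slopeLast := by
  have := Rat.num_nonneg.2 hI.bP_nonneg
  have := hI.slopeI_nonneg
  rw [slopeLast]
  positivity

theorem slope_nonneg (t : ℕ) : 0 ≤ I.slope t := by
  rcases I.slope_eq t with h | h <;> rw [h]
  exacts [hI.slopeI_nonneg, hI.slopeLast_nonneg]

theorem regular : (I.knapsack k).Regular where
  N_pos := Nat.succ_pos _
  LB_nonneg := maxSingleGain_nonneg _
  G_nonneg := mul_nonneg (Int.natCast_nonneg _) scale_pos.le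
  α_nonneg t := mul_nonneg denom_pos.le (hI.slope_nonneg t)
  β_nonneg := mul_nonneg denom_pos.le hI.slopeB_nonneg
  δ_nonneg t := mul_nonneg (deviation_nonneg t) scale_pos.le
  α_dvd t h := by
    have h1 : I.resolution k * (I.denom * I.slope t) ∣ I.scale k :=
      dvd_scale (pos_of_mul_pos_right h denom_pos.le)
        ((I.slope_eq t).imp id .inl)
    exact ⟨h1.trans (scale_dvd_maxSingleGain _), h1.trans (Dvd.intro_left _ rfl)⟩
  β_dvd t h := by
    have h1 : I.resolution k * (I.denom * I.slopeB) ∣ I.scale k :=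
      dvd_scale (pos_of_mul_pos_right h denom_pos.le) (.inr (.inr rfl))
    exact ⟨h1.trans (scale_dvd_maxSingleGain _), h1.trans (Dvd.intro_left _ rfl)⟩

end Admissible

/-! ### Bounds on the numbers -/

/-- `x` is at most `H ^ i` in absolute value. -/
def PowBounded (H : ℤ) (i : ℕ) (x : ℤ) : Prop := |x| ≤ H ^ i

namespace PowBounded

variable {H x y : ℤ} {i j : ℕ}

theorem neg (hx : PowBounded H i x) : PowBounded H i (-x) := by
  rwa [PowBounded, abs_neg]

theorem one : PowBounded H 0 1 := by
  simp [PowBounded]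

theorem zero : PowBounded H 0 0 := by
  simp [PowBounded]

variable (hH : 2 ≤ H)

include hH

theorem mono (hx : PowBounded H i x) (h : i ≤ j) : PowBounded H j x :=
  hx.trans (pow_le_pow_right₀ (by linarith) h)

theorem mul (hx : PowBounded H i x) (hy : PowBounded H j y) : PowBounded H (i + j) (x * y) := by
  rw [PowBounded, abs_mul, pow_add]
  exact mul_le_mul hx hy (abs_nonneg _) (by positivity)

/-- The additional power of `H ≥ 2` pays for the factor 2 of a sum. -/
theorem add (hx : PowBounded H i x) (hy : PowBounded H j y) :
    PowBounded H (i ⊔ j + 1) (x + y) := by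
  have h1 := hx.mono hH (le_max_left i j)
  have h2 := hy.mono hH (le_max_right i j)
  have h3 : 0 ≤ H ^ (i ⊔ j) := by positivity
  rw [PowBounded] at *
  rw [pow_succ]
  have := abs_add_le x y
  nlinarith

theorem sub (hx : PowBounded H i x) (hy : PowBounded H j y) :
    PowBounded H (i ⊔ j + 1) (x - y) := by
  rw [sub_eq_add_neg]
  exact hx.add hH (hy.neg)

theorem max (hx : PowBounded H i x) (hy : PowBounded H j y) :
    PowBounded H (i ⊔ j) (x ⊔ y) := by
  rcases max_choice x y with h | h <;> rw [h]
  exacts [hx.mono hH (le_max_left i j), hy.mono hH (le_max_right i j)]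

theorem min (hx : PowBounded H i x) (hy : PowBounded H j y) :
    PowBounded H (i ⊔ j) (x ⊓ y) := by
  rcases min_choice x y with h | h <;> rw [h]
  exacts [hx.mono hH (le_max_left i j), hy.mono hH (le_max_right i j)]

end PowBounded

theorem len_toArr_le {T : ℕ} {v : Fin T → ℤ} {n : ℕ} (h : ∀ t, len (v t) ≤ n) (i : ℕ) :
    len (toArr v i) ≤ n := by
  rw [toArr]
  split_ifs
  · exact h _
  · simp [len]

theorem len_num_le (q : ℚ) : len q.num ≤ ratLen q := Nat.le_add_right _ _

theorem len_den_le (q : ℚ) : len q.den ≤ ratLen q := Nat.le_add_left _ _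

theorem ratLen_pos (q : ℚ) : 0 < ratLen q :=
  lt_of_lt_of_le (Nat.size_pos.2 q.den_pos) (len_den_le q)

theorem len_natCast_le (n : ℕ) : len n ≤ n := by
  rw [len_le, Int.natAbs_natCast]
  exact Nat.lt_two_pow_self

theorem period_le_size (t : Fin I.T) :
    ratLen (I.Dhat t) + Nat.size (I.Δ t) + ratLen (I.x t) ≤ I.size := by
  have := Finset.single_le_sum
    (f := fun t => ratLen (I.Dhat t) + Nat.size (I.Δ t) + ratLen (I.x t))
    (fun _ _ => Nat.zero_le _) (Finset.mem_univ t)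
  rw [size]
  omega

theorem input_bounded : (I.input k).Bounded (I.size + k) := by
  have hs : I.T + ratLen I.cP + ratLen I.cI + ratLen I.cB + ratLen I.bP + Nat.size I.Γ ≤
      I.size := Nat.le_add_right _ _
  constructor
  · intro r
    rw [input]
    dsimp only
    split
    · exact (len_natCast_le _).trans (by omega)
    · exact (len_natCast_le _).trans (by omega)
    · change Nat.size I.Γ ≤ _
      omega
    · exact (len_num_le _).trans (by omega)
    · exact (len_den_le _).trans (by omega)
    · exact (len_num_le _).trans (by omega)
    · exact (len_den_le _).trans (by omega)
    · exact (len_num_le _).trans (by omega)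
    · exact (len_den_le _).trans (by omega)
    · exact (len_num_le _).trans (by omega)
    · exact (len_den_le _).trans (by omega)
    · simp [len]
  · intro A i
    rw [input]
    dsimp only
    split
    · refine len_toArr_le (fun t => (len_num_le _).trans ?_) i
      have := I.period_le_size t
      omega
    · refine len_toArr_le (fun t => (len_den_le _).trans ?_) i
      have := I.period_le_size t
      omega
    · refine len_toArr_le (fun t => ?_) i
      change Nat.size (I.Δ t) ≤ _
      have := I.period_le_size t
      omega
    · refine len_toArr_le (fun t => (len_num_le _).trans ?_) i
      have := I.period_le_size t
      omega
    · refine len_toArr_le (fun t => (len_den_le _).trans ?_) i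
      have := I.period_le_size t
      omega
    · simp [len]

theorem size_pos : 0 < I.size := by
  have := ratLen_pos I.cP
  rw [size]
  omega

variable (I k) in
/-- A bound on the input numbers. -/
def inputBound : ℤ := 2 ^ (I.size + k)

theorem two_le_inputBound : 2 ≤ I.inputBound k := by
  have h : 1 ≤ I.size + k := by have := I.size_pos; omega
  exact le_trans (by norm_num) (pow_le_pow_right₀ (by norm_num : (1 : ℤ) ≤ 2) h)

theorem powBounded_of_len {x : ℤ} (h : len x ≤ I.size + k) :
    PowBounded (I.inputBound k) 1 x := by
  rw [len_le] at h
  rw [PowBounded, pow_one, inputBound, Int.abs_eq_natAbs]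
  exact_mod_cast h.le

theorem powBounded_reg (r : ℕ) : PowBounded (I.inputBound k) 1 ((I.input k).reg r) :=
  powBounded_of_len (input_bounded.1 r)

theorem powBounded_arr (A i : ℕ) : PowBounded (I.inputBound k) 1 ((I.input k).arr A i) :=
  powBounded_of_len (input_bounded.2 A i)

/-- The exponent is 1 although up to 2T denominators are multiplied: bit lengths add, and their
total is part of `size`. -/
theorem powBounded_denomUpTo {n : ℕ} (hn : n ≤ I.T) :
    PowBounded (I.inputBound k) 1 (I.denomUpTo n) := by
  rw [PowBounded, pow_one, abs_of_pos (denomUpTo_pos hn)]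
  -- A partial product divides the full one, so it suffices to bound the full product.
  have h1 : I.denomUpTo n ≤ I.denomUpTo I.T :=
    Int.le_of_dvd denom_pos (Finset.prod_dvd_prod_of_subset _ _ _ (Finset.range_subset_range.2 hn))
  refine h1.trans ?_
  have h2 : I.denomUpTo I.T = ∏ t : Fin I.T, ((I.Dhat t).den * (I.x t).den : ℤ) := by
    rw [denomUpTo, Finset.prod_range]
    refine Finset.prod_congr rfl fun t _ => ?_
    rw [demandDen, prodDen, toArr_lt t.2, toArr_lt t.2]
  rw [h2]
  calc ∏ t : Fin I.T, ((I.Dhat t).den * (I.x t).den : ℤ)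
      ≤ ∏ t : Fin I.T, (2 : ℤ) ^ (ratLen (I.Dhat t) + Nat.size (I.Δ t) + ratLen (I.x t)) := by
        refine Finset.prod_le_prod (fun t _ => by positivity) fun t _ => ?_
        have h3 : (I.Dhat t).den < 2 ^ ratLen (I.Dhat t) := Nat.size_le.1 (len_den_le _)
        have h4 : (I.x t).den < 2 ^ ratLen (I.x t) := Nat.size_le.1 (len_den_le _)
        have h5 : 1 ≤ 2 ^ Nat.size (I.Δ t) := Nat.one_le_two_pow
        rw [pow_add, pow_add]
        have h6 : (I.Dhat t).den * (I.x t).den ≤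
            2 ^ ratLen (I.Dhat t) * 2 ^ Nat.size (I.Δ t) * 2 ^ ratLen (I.x t) :=
          Nat.mul_le_mul (h3.le.trans (Nat.le_mul_of_pos_right _ h5)) h4.le
        exact_mod_cast h6
    _ = 2 ^ ∑ t : Fin I.T, (ratLen (I.Dhat t) + Nat.size (I.Δ t) + ratLen (I.x t)) :=
        Finset.prod_pow_eq_pow_sum _ _ _
    _ ≤ _ := by
        refine pow_le_pow_right₀ (by norm_num) ?_
        rw [size]
        omega

section Bounds

local notation "H" => I.inputBound k

theorem powBounded_denom : PowBounded H 1 I.denom := powBounded_denomUpTo le_rfl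

theorem powBounded_slopeI : PowBounded H 3 I.slopeI :=
  (powBounded_reg 5).mul two_le_inputBound
    ((powBounded_reg 8).mul two_le_inputBound (powBounded_reg 10))

theorem powBounded_slopeB : PowBounded H 3 I.slopeB :=
  (powBounded_reg 7).mul two_le_inputBound
    ((powBounded_reg 6).mul two_le_inputBound (powBounded_reg 10))

theorem powBounded_slopeLast : PowBounded H 4 I.slopeLast :=
  powBounded_slopeI.add two_le_inputBound ((powBounded_reg 9).mul two_le_inputBound
    ((powBounded_reg 6).mul two_le_inputBound (powBounded_reg 8)))

theorem powBounded_slope (t : ℕ) : PowBounded H 4 (I.slope t) := by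
  rcases I.slope_eq t with h | h <;> rw [h]
  exacts [powBounded_slopeI.mono two_le_inputBound (by norm_num), powBounded_slopeLast]

theorem powBounded_resolution : PowBounded H 3 (I.resolution k) := by
  rw [resolution]
  push_cast
  exact ((powBounded_reg 1).mul two_le_inputBound (powBounded_reg 0)).add two_le_inputBound
    .one

theorem powBounded_scale : PowBounded H 14 (I.scale k) := by
  have h := two_le_inputBound (I := I) (k := k)
  exact (((powBounded_resolution.mul h powBounded_denom).mul h
    ((PowBounded.one).max h powBounded_slopeI)).mul h
    ((PowBounded.one).max h powBounded_slopeLast)).mul h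
    ((PowBounded.one).max h powBounded_slopeB)

theorem powBounded_budget : PowBounded H 15 (I.Γ * I.scale k) :=
  (powBounded_reg 2).mul two_le_inputBound powBounded_scale

theorem powBounded_width : PowBounded H 5 (I.knapsack k).width := by
  rw [Knapsack.width]
  push_cast
  exact ((powBounded_reg 0).mul two_le_inputBound powBounded_resolution).add two_le_inputBound
    .one

theorem powBounded_denom_div (x : ℤ) : PowBounded H 1 (I.denom / x) := by
  refine le_trans ?_ powBounded_denom
  rw [Int.abs_eq_natAbs, Int.abs_eq_natAbs]
  exact_mod_cast Int.natAbs_ediv_le_natAbs _ _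

/-- Each summand is at most `H ^ 2`, and the number of summands is at most `T ≤ H`. -/
theorem powBounded_scaledProd {n : ℕ} (hn : n ≤ I.T) : PowBounded H 3 (I.scaledProd n) := by
  have h : |I.scaledProd n| ≤ n * H ^ 2 := by
    refine (Finset.abs_sum_le_sum_abs _ _).trans ?_
    refine (Finset.sum_le_card_nsmul _ _ (H ^ 2) fun t _ =>
      (powBounded_arr 3 t).mul two_le_inputBound (powBounded_denom_div _)).trans ?_
    simp
  refine h.trans ?_
  have h1 : |(I.T : ℤ)| ≤ H ^ 1 := powBounded_reg 0
  rw [Nat.abs_cast, pow_one] at h1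
  have h2 : (n : ℤ) ≤ I.T := by exact_mod_cast hn
  have h3 : (0 : ℤ) ≤ H ^ 2 := by positivity
  rw [pow_succ' H 2]
  exact mul_le_mul_of_nonneg_right (h2.trans h1) h3

theorem powBounded_excess {t : ℕ} (ht : t < I.T) : PowBounded H 4 (I.excess t) :=
  (powBounded_scaledProd ht).sub two_le_inputBound
    ((powBounded_arr 0 t).mul two_le_inputBound (powBounded_denom_div _))

theorem powBounded_offset {t : ℕ} (ht : t < I.T) : PowBounded H 23 (I.offset k t) := by
  have h := two_le_inputBound (I := I) (k := k)
  exact (((powBounded_slope t).add h powBounded_slopeB).mul h (powBounded_excess ht)).mul h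
    powBounded_scale

theorem powBounded_α (t : ℕ) : PowBounded H 5 (I.denom * I.slope t) :=
  powBounded_denom.mul two_le_inputBound (powBounded_slope t)

theorem powBounded_β : PowBounded H 4 (I.denom * I.slopeB) :=
  powBounded_denom.mul two_le_inputBound powBounded_slopeB

theorem powBounded_δ (t : ℕ) : PowBounded H 15 (I.deviation t * I.scale k) :=
  (powBounded_arr 2 t).mul two_le_inputBound powBounded_scale

theorem powBounded_singleGain {t : ℕ} (ht : t < I.T) :
    PowBounded H 24 (I.singleGain k t) := by
  have h := two_le_inputBound (I := I) (k := k)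
  have hz := powBounded_offset (k := k) ht
  have hm := (powBounded_δ (k := k) t).min h powBounded_budget
  exact (((powBounded_α t).mul h hm).sub h ((PowBounded.zero).max h (hz.neg))).max h
    ((powBounded_β.mul h hm).sub h ((PowBounded.zero).max h hz))

theorem powBounded_maxSingleGain {n : ℕ} (hn : n ≤ I.T) :
    PowBounded H 24 (I.maxSingleGain k n) := by
  have h := two_le_inputBound (I := I) (k := k)
  induction n with
  | zero => exact (PowBounded.zero).mono h (by norm_num)
  | succ n ih => exact (ih (by omega)).max h (powBounded_singleGain hn)

/-- The exponent 24 is that of the single gains, the largest numbers bounded above. Using 25 in the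
conclusion gives the strict inequality that a bit length requires. -/
theorem len_le_of_powBounded {x : ℤ} {i : ℕ} (hx : PowBounded H i x) (hi : i ≤ 24) :
    len x ≤ 25 * (I.size + k) := by
  have h1 : PowBounded H 24 x := hx.mono two_le_inputBound hi
  rw [len_le, ← Nat.cast_lt (α := ℤ), ← Int.abs_eq_natAbs]
  refine lt_of_le_of_lt h1 ?_
  rw [inputBound, ← pow_mul]
  push_cast
  refine pow_lt_pow_right₀ (by norm_num) ?_
  have := I.size_pos
  omega

theorem T_le_width : I.T ≤ (I.knapsack k).width := by
  change I.T ≤ I.T * (k * I.T + 1) + 1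
  nlinarith [Nat.zero_le (I.T * (k * I.T))]

theorem fits : Knapsack.Fits (I.knapsack k) (I.scale k) I.demandNum I.demandDen
    (25 * (I.size + k)) (I.knapsack k).width (H ^ 24) := by
  have h := two_le_inputBound (I := I) (k := k)
  constructor
  · have := I.size_pos
    omega
  · exact fun z hz => len_le_of_powBounded hz le_rfl
  · exact (le_abs_self _).trans
      (((powBounded_budget.add h .one).mono h (by norm_num) : PowBounded H 24 _))
  · exact fun t _ => (le_abs_self _).trans ((powBounded_δ t).mono h (by norm_num))
  · exact (le_abs_self _).trans ((((powBounded_reg 0).add h .one).mul h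
      powBounded_width).mono h (by norm_num) : PowBounded H 24 _)
  · intro t _
    have h1 : PowBounded H 24 (|I.demandNum t| * |I.scale k| + I.Γ * I.scale k * |I.demandDen t|) :=
      (PowBounded.add h (i := 15) (j := 16) (PowBounded.mul h (i := 1) (j := 14) ?_ ?_)
        (PowBounded.mul h (i := 15) (j := 1) powBounded_budget ?_)).mono h (by norm_num)
    · exact (le_abs_self _).trans h1
    all_goals rw [PowBounded, abs_abs]
    exacts [powBounded_arr 0 t, powBounded_scale, powBounded_arr 1 t]
  · exact fun t _ => ((powBounded_arr 1 t).mul h powBounded_scale).mono h (by norm_num)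
  · exact T_le_width
  · exact le_rfl

end Bounds

end AdvInstance

/-! ## The preprocessing program

Registers: `11` common denominator, `12`, `13` and `14` slopes, `15` resolution, `16` scale,
`17` budget, `18` width of the tables, `19` largest single gain, `20` slope `β`, `21` period,
`28` scaled production. -/

namespace AdvInstance

open RAM

/-- Computation of the common denominator. -/
def denomProg : Prog := .block [
  .set 11 (.lit 1),
  .set 21 (.lit 0),
  .loop (.reg 0 - .reg 21) (.block [
    .set 11 (.reg 11 * (.get 1 (.reg 21) * .get 4 (.reg 21))),
    .set 21 (.reg 21 + .lit 1)])]

/-- Computation of the global data of the knapsack problem. -/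
def globalProg : Prog := .block [
  .set 12 (.reg 5 * (.reg 8 * .reg 10)),
  .set 13 (.reg 12 + .reg 9 * (.reg 6 * .reg 8)),
  .set 14 (.reg 7 * (.reg 6 * .reg 10)),
  .set 15 (.reg 1 * .reg 0 + .lit 1),
  .set 16 (.reg 15 * .reg 11 * Expr.max (.lit 1) (.reg 12) * Expr.max (.lit 1) (.reg 13) *
    Expr.max (.lit 1) (.reg 14)),
  .set 17 (.reg 2 * .reg 16),
  .set 18 (.reg 0 * .reg 15 + .lit 1),
  .set 20 (.reg 11 * .reg 14)]

/-- Computes the slope of a period. -/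
def slopeExpr : Expr := Expr.cond (.reg 0 - .reg 21 - .lit 1) (.reg 12) (.reg 13)

/-- Computes the largest feasible amount for a period alone. -/
def maxAmountExpr : Expr := Expr.min (.get 2 (.reg 21) * .reg 16) (.reg 17)

/-- Computation of the data of a period. -/
def periodStep : Prog := .block [
  .set 28 (.reg 28 + .get 3 (.reg 21) * (.reg 11 / .get 4 (.reg 21))),
  .put 7 (.reg 21) (.reg 11 * slopeExpr),
  .put 8 (.reg 21) ((slopeExpr + .reg 14) *
    (.reg 28 - .get 0 (.reg 21) * (.reg 11 / .get 1 (.reg 21))) * .reg 16),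
  .set 19 (Expr.max (.reg 19) (Expr.max
    (.get 7 (.reg 21) * maxAmountExpr - Expr.max (.lit 0) (.lit 0 - .get 8 (.reg 21)))
    (.reg 20 * maxAmountExpr - Expr.max (.lit 0) (.get 8 (.reg 21))))),
  .set 21 (.reg 21 + .lit 1)]

/-- Computation of the data of all periods. -/
def periodProg : Prog := .block [
  .set 19 (.lit 0),
  .set 21 (.lit 0),
  .set 28 (.lit 0),
  .loop (.reg 0 - .reg 21) periodStep]

/-- The approximation scheme. -/
def scheme : Prog := .block [denomProg, globalProg, periodProg,
  .block [Knapsack.fill, Knapsack.search, Knapsack.backtrack]]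

variable {I : AdvInstance} {k : ℕ}

/-- The memory still contains the input, apart from output and working space. -/
structure KeepsInput (I : AdvInstance) (k : ℕ) (s : State) : Prop where
  reg : ∀ r < 11, s.reg r = (I.input k).reg r
  arr : ∀ A, A < 7 ∨ A = 9 → s.arr A = (I.input k).arr A

theorem KeepsInput.setReg {s : State} (h : KeepsInput I k s) {r : ℕ} (hr : 11 ≤ r) (x : ℤ) :
    KeepsInput I k (s.setReg r x) :=
  ⟨fun r' hr' => by rw [reg_setReg, if_neg (by omega), h.reg r' hr'], h.arr⟩

theorem KeepsInput.setArr {s : State} (h : KeepsInput I k s) {A : ℕ} (hA : A = 7 ∨ A = 8)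
    (i : ℕ) (x : ℤ) : KeepsInput I k (s.setArr A i x) :=
  ⟨h.reg, fun A' hA' => by funext j; rw [arr_setArr, if_neg (by omega), h.arr A' hA']⟩

/-- The memory contains the global data of the knapsack problem. -/
structure HasGlobals (I : AdvInstance) (k : ℕ) (s : State) : Prop where
  input : KeepsInput I k s
  denom : s.reg 11 = I.denom
  slopeI : s.reg 12 = I.slopeI
  slopeLast : s.reg 13 = I.slopeLast
  slopeB : s.reg 14 = I.slopeB
  resolution : s.reg 15 = I.resolution k
  scale : s.reg 16 = I.scale k
  budget : s.reg 17 = I.Γ * I.scale k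
  width : s.reg 18 = (I.knapsack k).width
  β : s.reg 20 = I.denom * I.slopeB

theorem HasGlobals.setReg {s : State} (h : HasGlobals I k s) {r : ℕ} (hr : r = 19 ∨ 21 ≤ r)
    (x : ℤ) : HasGlobals I k (s.setReg r x) := by
  obtain ⟨h0, h1, h2, h3, h4, h5, h6, h7, h8, h9⟩ := h
  refine ⟨h0.setReg (by omega) x, ?_, ?_, ?_, ?_, ?_, ?_, ?_, ?_, ?_⟩ <;>
  · rw [reg_setReg, if_neg (by omega)]
    assumption

theorem HasGlobals.setArr {s : State} (h : HasGlobals I k s) {A : ℕ} (hA : A = 7 ∨ A = 8)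
    (i : ℕ) (x : ℤ) : HasGlobals I k (s.setArr A i x) :=
  ⟨h.input.setArr hA i x, h.denom, h.slopeI, h.slopeLast, h.slopeB, h.resolution, h.scale,
    h.budget, h.width, h.β⟩

/-! ### Verification of the preprocessing and of the whole scheme. -/

section

local notation "B" => 25 * (I.size + k)
local notation "M" => Knapsack.width (I.knapsack k)

theorem runs_denomProg {s : State} (hs : s.Bounded B) (h : KeepsInput I k s) :
    Runs B M denomProg s fun s => KeepsInput I k s ∧ s.reg 11 = I.denom := by
  have hB := (fits (I := I) (k := k)).B_pos
  refine Runs.set hB hs (z := 1) rfl (len_le_of_powBounded .one (by norm_num)) fun hs => ?_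
  refine Runs.set hB hs (z := 0) rfl (len_le_of_powBounded .zero (by norm_num)) fun hs => ?_
  refine Runs.cons (Runs.loop hB (n := I.T) T_le_width
    (fun t s => KeepsInput I k s ∧ s.reg 21 = t ∧ s.reg 11 = I.denomUpTo t) ?_ ?_ hs ?_)
    fun s hs h => Runs.nil hB hs ⟨h.1, h.2.2⟩
  · rintro t s - ⟨h, h21, -⟩
    rw [eval_sub, eval_reg, eval_reg, h.reg 0 (by norm_num), h21]
    rfl
  · rintro t s ht hs ⟨h, h21, h11⟩
    refine Runs.set hB hs (z := I.denomUpTo (t + 1)) ?_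
      (len_le_of_powBounded (powBounded_denomUpTo ht) (by norm_num)) fun hs => ?_
    · rw [eval_mul, eval_mul, Knapsack.eval_get_natCast (i := t) (by simp [h21]),
        Knapsack.eval_get_natCast (i := t) (by simp [h21]), eval_reg, h11, h.arr 1 (by norm_num),
        h.arr 4 (by norm_num), denomUpTo, denomUpTo, Finset.prod_range_succ]
      rfl
    refine Runs.set hB hs (z := (t + 1 : ℕ)) (by simp [h21])
      (fits.len_natCast_le' (Nat.succ_le_of_lt ht)) fun hs => ?_
    exact Runs.nil hB hs ⟨(h.setReg (by norm_num) _).setReg (by norm_num) _, by simp, by simp⟩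
  · exact ⟨(h.setReg (by norm_num) _).setReg (by norm_num) _, by simp, by simp [denomUpTo]⟩

theorem runs_globalProg {s : State} (hs : s.Bounded B)
    (h : KeepsInput I k s ∧ s.reg 11 = I.denom) :
    Runs B M globalProg s (HasGlobals I k) := by
  have hB := (fits (I := I) (k := k)).B_pos
  obtain ⟨h, h11⟩ := h
  have hr : s.reg 0 = I.T ∧ s.reg 1 = k ∧ s.reg 2 = I.Γ ∧ s.reg 5 = I.cI.num ∧
      s.reg 6 = I.cI.den ∧ s.reg 7 = I.cB.num ∧ s.reg 8 = I.cB.den ∧ s.reg 9 = I.bP.num ∧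
      s.reg 10 = I.bP.den := by
    refine ⟨?_, ?_, ?_, ?_, ?_, ?_, ?_, ?_, ?_⟩ <;> exact h.reg _ (by norm_num)
  obtain ⟨h0, h1, h2, h5, h6, h7, h8, h9, h10⟩ := hr
  refine Runs.set hB hs (z := I.slopeI) (by simp [h5, h8, h10, slopeI])
    (len_le_of_powBounded powBounded_slopeI (by norm_num)) fun hs => ?_
  refine Runs.set hB hs (z := I.slopeLast) (by simp [h6, h8, h9, slopeLast])
    (len_le_of_powBounded powBounded_slopeLast (by norm_num)) fun hs => ?_
  refine Runs.set hB hs (z := I.slopeB) (by simp [h6, h7, h10, slopeB])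
    (len_le_of_powBounded powBounded_slopeB (by norm_num)) fun hs => ?_
  refine Runs.set hB hs (z := I.resolution k) (by simp [h0, h1, resolution])
    (len_le_of_powBounded powBounded_resolution (by norm_num)) fun hs => ?_
  refine Runs.set hB hs (z := I.scale k) (by simp [h11, scale])
    (len_le_of_powBounded powBounded_scale (by norm_num)) fun hs => ?_
  refine Runs.set hB hs (z := I.Γ * I.scale k) (by simp [h2])
    (len_le_of_powBounded powBounded_budget (by norm_num)) fun hs => ?_
  refine Runs.set hB hs (z := (I.knapsack k).width)
    (by simp [h0, Knapsack.width, knapsack])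
    (len_le_of_powBounded powBounded_width (by norm_num)) fun hs => ?_
  refine Runs.set hB hs (z := I.denom * I.slopeB) (by simp [h11])
    (len_le_of_powBounded powBounded_β (by norm_num)) fun hs => ?_
  refine Runs.nil hB hs ⟨?_, ?_, ?_, ?_, ?_, ?_, ?_, ?_, ?_, ?_⟩
  · iterate 8 refine KeepsInput.setReg ?_ (by norm_num) _
    exact h
  all_goals simp [h11]

/-- The data of the first `t` periods have been computed. -/
def HasPeriods (I : AdvInstance) (k t : ℕ) (s : State) : Prop :=
  (∀ i < t, s.arr 7 i = I.denom * I.slope i) ∧ (∀ i < t, s.arr 8 i = I.offset k i) ∧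
    s.reg 19 = I.maxSingleGain k t ∧ s.reg 21 = t ∧ s.reg 28 = I.scaledProd t

theorem eval_slopeExpr {s : State} (h : HasGlobals I k s) {t : ℕ} (h21 : s.reg 21 = t) :
    slopeExpr.eval s = I.slope t := by
  have h0 : s.reg 0 = I.T := h.input.reg 0 (by norm_num)
  simp only [slopeExpr, eval_cond, eval_sub, eval_reg, eval_lit, h21, h0, h.slopeI, h.slopeLast,
    slope]

theorem eval_maxAmountExpr {s : State} (h : HasGlobals I k s) {t : ℕ} (h21 : s.reg 21 = t) :
    maxAmountExpr.eval s = min (I.deviation t * I.scale k) (I.Γ * I.scale k) := by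
  rw [maxAmountExpr, eval_min, eval_mul, Knapsack.eval_get_natCast (i := t) (by simp [h21]),
    eval_reg, eval_reg, h.scale, h.budget, h.input.arr 2 (by norm_num)]
  rfl

theorem runs_periodStep {t : ℕ} (ht : t < I.T) {s : State} (hs : s.Bounded B)
    (h : HasGlobals I k s ∧ HasPeriods I k t s) :
    Runs B M periodStep s fun s => HasGlobals I k s ∧ HasPeriods I k (t + 1) s := by
  have hB := (fits (I := I) (k := k)).B_pos
  obtain ⟨h, h7, h8, h19, h21, h28⟩ := h
  refine Runs.set hB hs (z := I.scaledProd (t + 1)) ?_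
    (len_le_of_powBounded (powBounded_scaledProd ht) (by norm_num)) fun hs => ?_
  · rw [eval_add, eval_mul, eval_div, Knapsack.eval_get_natCast (i := t) (by simp [h21]),
      Knapsack.eval_get_natCast (i := t) (by simp [h21]), eval_reg, eval_reg, h28, h.denom,
      h.input.arr 3 (by norm_num), h.input.arr 4 (by norm_num), scaledProd, scaledProd,
      Finset.sum_range_succ]
    rfl
  replace h := h.setReg (r := 28) (by norm_num) (I.scaledProd (t + 1))
  refine Runs.put hB hs (j := t) (z := I.denom * I.slope t) (by simp [h21]) ?_
    (len_le_of_powBounded (powBounded_α t) (by norm_num)) fun hs => ?_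
  · rw [eval_mul, eval_slopeExpr h (t := t) (by simp [h21]), eval_reg, h.denom]
  replace h := h.setArr (A := 7) (by norm_num) t (I.denom * I.slope t)
  refine Runs.put hB hs (j := t) (z := I.offset k t) (by simp [h21]) ?_
    (len_le_of_powBounded (powBounded_offset ht) (by norm_num)) fun hs => ?_
  · rw [eval_mul, eval_mul, eval_add, eval_sub, eval_mul, eval_div,
      eval_slopeExpr h (t := t) (by simp [h21]), Knapsack.eval_get_natCast (i := t) (by simp [h21]),
      Knapsack.eval_get_natCast (i := t) (by simp [h21]), eval_reg, eval_reg, eval_reg, eval_reg,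
      h.slopeB, h.denom, h.scale, h.input.arr 0 (by norm_num), h.input.arr 1 (by norm_num)]
    simp only [reg_setArr, reg_setReg, if_true]
    rfl
  replace h := h.setArr (A := 8) (by norm_num) t (I.offset k t)
  refine Runs.set hB hs (z := I.maxSingleGain k (t + 1)) ?_
    (len_le_of_powBounded (powBounded_maxSingleGain ht) (by norm_num)) fun hs => ?_
  · rw [eval_max, eval_max, eval_sub, eval_sub, eval_mul, eval_mul,
      eval_maxAmountExpr h (t := t) (by simp [h21]), eval_max, eval_max, eval_sub,
      Knapsack.eval_get_natCast (i := t) (by simp [h21]),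
      Knapsack.eval_get_natCast (i := t) (by simp [h21]), eval_lit, eval_reg, eval_reg, h.β]
    simp [h19, maxSingleGain, singleGain]
  replace h := h.setReg (r := 19) (by norm_num) (I.maxSingleGain k (t + 1))
  refine Runs.set hB hs (z := (t + 1 : ℕ)) (by simp [h21])
    (fits.len_natCast_le' (Nat.succ_le_of_lt ht)) fun hs => ?_
  refine Runs.nil hB hs ⟨h.setReg (by norm_num) _, ?_, ?_, by simp, by simp, by simp⟩
  · intro i hi
    by_cases h' : i = t
    · simp [h']
    · simp [h', h7 i (by omega)]
  · intro i hi
    by_cases h' : i = t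
    · simp [h']
    · simp [h', h8 i (by omega)]

theorem runs_periodProg {s : State} (hs : s.Bounded B) (h : HasGlobals I k s) :
    Runs B M periodProg s fun s => HasGlobals I k s ∧ HasPeriods I k I.T s := by
  have hB := (fits (I := I) (k := k)).B_pos
  have h0 : len 0 ≤ B := len_le_of_powBounded .zero (by norm_num)
  refine Runs.set hB hs (z := 0) rfl h0 fun hs => ?_
  refine Runs.set hB hs (z := 0) rfl h0 fun hs => ?_
  refine Runs.set hB hs (z := 0) rfl h0 fun hs => ?_
  refine Runs.cons (Runs.loop hB (n := I.T) T_le_width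
    (fun t s => HasGlobals I k s ∧ HasPeriods I k t s) ?_
    (fun t s ht hs h => runs_periodStep ht hs h) hs ?_)
    fun s hs h => Runs.nil hB hs h
  · rintro t s - ⟨h, -, -, -, h21, -⟩
    rw [eval_sub, eval_reg, eval_reg, h.input.reg 0 (by norm_num), h21]
    rfl
  · refine ⟨((h.setReg (by norm_num) _).setReg (by norm_num) _).setReg (by norm_num) _,
      ?_, ?_, ?_⟩
    · simp
    · simp
    · simp [maxSingleGain, scaledProd]

theorem HasPeriods.loaded {s : State} (h : HasGlobals I k s) (hp : HasPeriods I k I.T s) :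
    (I.knapsack k).Loaded (I.scale k) I.demandNum I.demandDen s where
  T := h.input.reg 0 (by norm_num)
  N := h.resolution
  scale := h.scale
  G := h.budget
  width := h.width
  LB := hp.2.2.1
  β := h.β
  num := h.input.arr 0 (by norm_num)
  den := h.input.arr 1 (by norm_num)
  δ t _ := by rw [h.input.arr 2 (by norm_num)]; rfl
  α := hp.1
  z := hp.2.1

/-- What the approximation scheme computes. -/
theorem runs_scheme (hI : I.Admissible) :
    Runs B M scheme (I.input k) fun s => ∀ t < I.T,
      s.arr 5 t = I.demandNum t * I.scale k + (I.knapsack k).signedSolution t * I.demandDen t ∧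
        s.arr 6 t = I.demandDen t * I.scale k := by
  have hs : (I.input k).Bounded B :=
    ⟨fun r => (input_bounded.1 r).trans (by omega),
      fun A i => (input_bounded.2 A i).trans (by omega)⟩
  refine Runs.cons (runs_denomProg hs ⟨fun _ _ => rfl, fun _ _ => rfl⟩) fun s hs h => ?_
  refine Runs.cons (runs_globalProg hs h) fun s hs h => ?_
  refine Runs.cons (runs_periodProg hs h) fun s hs h => ?_
  refine Runs.cons (Knapsack.runs_solve fits hI.regular hs (h.2.loaded h.1) fun i => ?_)
    fun s hs h => Runs.nil fits.B_pos hs h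
  rw [h.1.input.arr 9 (by norm_num)]
  rfl

end

end AdvInstance

/-! ## Correctness of the approximation scheme -/

namespace AdvInstance

open RAM

variable {I : AdvInstance} {k : ℕ}

variable (I k) in
/-- The factor between gains in the knapsack problem and costs. -/
def costScale : ℤ := I.cI.den * I.cB.den * I.bP.den * I.denom * I.scale k

theorem costScale_pos : 0 < I.costScale k := by
  have h1 := I.cI.den_pos
  have h2 := I.cB.den_pos
  have h3 := I.bP.den_pos
  have h4 : 0 < I.denom := denom_pos
  have h5 := I.scale_pos (k := k)
  rw [costScale]
  positivity

variable (I) in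
/-- The rate at which the cost of period `t` increases for small demands. -/
noncomputable def rate (t : Fin I.T) : ℝ :=
  if (t : ℕ) + 1 = I.T then I.cI + I.bP else I.cI

variable (I) in
/-- The part of the cost of period `t` that does not depend on the demand. -/
noncomputable def fixedCost (t : Fin I.T) : ℝ :=
  if (t : ℕ) + 1 = I.T then I.cP * I.X t - I.bP * I.X t else 0

/-- In the last period the revenue `bP * D` of the inventory branch is split as `bP * X - bP * (X -
D)`. This raises the rate to `cI + bP` and leaves a part common to both branches. -/
theorem period_cost_eq (t : Fin I.T) (D : ℝ) :
    max (I.fI t (I.X t) D) (I.fB t (I.X t) D) =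
      I.fixedCost t + max (I.rate t * (I.X t - D)) (I.cB * (D - I.X t)) := by
  rw [← max_add_add_left, fI, fB, fixedCost, rate]
  split_ifs
  · congr 1 <;> ring
  · rw [zero_add, zero_add]

theorem num_mul_div {q : ℚ} {m : ℤ} (h : (q.den : ℤ) ∣ m) :
    ((q.num * (m / q.den) : ℤ) : ℝ) = m * q := by
  have h0 : (q.den : ℝ) ≠ 0 := by exact_mod_cast q.den_nz
  rw [Int.cast_mul, Int.cast_div h (by exact_mod_cast q.den_nz)]
  conv_rhs => rw [Rat.cast_def]
  push_cast
  field_simp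

theorem scaledProd_eq (t : Fin I.T) : (I.scaledProd (t + 1) : ℝ) = I.denom * I.X t := by
  rw [scaledProd, X, Int.cast_sum, Finset.mul_sum, Finset.sum_filter]
  have h : ∑ i ∈ Finset.range (t + 1), ((I.prodNum i * (I.denom / I.prodDen i) : ℤ) : ℝ) =
      ∑ i ∈ Finset.range I.T, if i ≤ (t : ℕ) then
        ((I.prodNum i * (I.denom / I.prodDen i) : ℤ) : ℝ) else 0 := by
    rw [← Finset.sum_filter]
    refine Finset.sum_congr ?_ fun _ _ => rfl
    ext i
    simp only [Finset.mem_range, Finset.mem_filter]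
    omega
  rw [h, Finset.sum_range]
  refine Finset.sum_congr rfl fun i _ => ?_
  simp only [Fin.le_def]
  refine if_congr Iff.rfl ?_ rfl
  have hd := prodDen_dvd (I := I) i.2
  rw [prodDen, toArr_lt i.2] at hd
  rw [prodNum, prodDen, toArr_lt i.2, toArr_lt i.2]
  exact num_mul_div hd

theorem excess_eq (t : Fin I.T) : (I.excess t : ℝ) = I.denom * (I.X t - I.nominal t) := by
  rw [excess, Int.cast_sub, scaledProd_eq, mul_sub]
  congr 1
  have hd := demandDen_dvd (I := I) t.2
  rw [demandDen, toArr_lt t.2] at hd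
  rw [demandNum, demandDen, toArr_lt t.2, toArr_lt t.2]
  exact num_mul_div hd

theorem num_eq_den_mul (q : ℚ) : (q.num : ℝ) = q.den * q := by
  have h0 : (q.den : ℝ) ≠ 0 := by exact_mod_cast q.den_nz
  conv_rhs => rw [Rat.cast_def]
  field_simp

theorem slope_eq_rate (t : Fin I.T) :
    (I.slope t : ℝ) = I.cI.den * I.cB.den * I.bP.den * I.rate t := by
  have ht := t.2
  rw [slope, rate]
  by_cases h : (t : ℕ) + 1 = I.T
  · rw [if_pos h, if_neg (by omega), slopeLast, slopeI]
    push_cast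
    rw [num_eq_den_mul, num_eq_den_mul]
    ring
  · rw [if_neg h, if_pos (by omega), slopeI]
    push_cast
    rw [num_eq_den_mul]
    ring

theorem slopeB_eq : (I.slopeB : ℝ) = I.cI.den * I.cB.den * I.bP.den * I.cB := by
  rw [slopeB]
  push_cast
  rw [num_eq_den_mul]
  ring

/-- The scaled cost of period `t` for a demand that deviates by `u` units from the nominal one. -/
noncomputable def scaledPeriodCost (I : AdvInstance) (k : ℕ) (t : ℕ) (u : ℝ) : ℝ :=
  max (I.slope t * I.excess t * I.scale k - I.denom * I.slope t * u)
    (I.denom * I.slopeB * u - I.slopeB * I.excess t * I.scale k)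

/-- The factor clears the denominators of the rates, the production amounts and the nominal demands;
deviations are measured in units of 1 / `scale`. -/
theorem costScale_mul_period_cost (t : Fin I.T) (D : ℝ) :
    I.costScale k * max (I.fI t (I.X t) D) (I.fB t (I.X t) D) =
      I.costScale k * I.fixedCost t +
        I.scaledPeriodCost k t ((D - I.nominal t) * I.scale k) := by
  have h : (0 : ℝ) ≤ I.costScale k := by exact_mod_cast costScale_pos.le
  rw [period_cost_eq, mul_add, mul_max_of_nonneg _ _ h, scaledPeriodCost, slope_eq_rate,
    slopeB_eq, excess_eq, costScale]
  push_cast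
  congr 2 <;> ring

/-- With `p` and `-r` the two branches at deviation 0, the offset is `p + r`. Its negative and
positive parts are the shortfalls of the branches below their maximum, so adding them back restores
both branches, each now increasing in `u`. -/
theorem scaledPeriodCost_add_gain (t : ℕ) (u : ℝ) :
    I.scaledPeriodCost k t 0 + (I.knapsack k).gain t u =
      max (I.slope t * I.excess t * I.scale k + I.denom * I.slope t * u)
        (I.denom * I.slopeB * u - I.slopeB * I.excess t * I.scale k) := by
  have hz : (I.offset k t : ℝ) = I.slope t * I.excess t * I.scale k -
      -(I.slopeB * I.excess t * I.scale k) := by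
    rw [offset]
    push_cast
    ring
  rw [scaledPeriodCost, Knapsack.gain, ← max_add_add_left]
  simp only [knapsack]
  push_cast
  rw [hz]
  generalize (I.slope t * I.excess t * I.scale k : ℝ) = p
  generalize (I.slopeB * I.excess t * I.scale k : ℝ) = r
  rw [mul_zero, mul_zero, sub_zero, zero_sub]
  rcases le_total p (-r) with h | h
  · rw [max_eq_right h, max_eq_right (by linarith : 0 ≤ -(p - -r)),
      max_eq_left (by linarith : p - -r ≤ 0)]
    congr 1 <;> ring
  · rw [max_eq_left h, max_eq_left (by linarith : -(p - -r) ≤ 0),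
      max_eq_right (by linarith : 0 ≤ p - -r)]
    congr 1 <;> ring

/-- Both slopes are nonnegative, so -u and u may each be replaced by |u| in their branch. -/
theorem Admissible.scaledPeriodCost_le (hI : I.Admissible) (t : ℕ) (u : ℝ) :
    I.scaledPeriodCost k t u ≤ I.scaledPeriodCost k t 0 + (I.knapsack k).gain t |u| := by
  have h1 : (0 : ℝ) ≤ I.denom * I.slope t := by
    exact_mod_cast mul_nonneg denom_pos.le (hI.slope_nonneg t)
  have h2 : (0 : ℝ) ≤ I.denom * I.slopeB := by
    exact_mod_cast mul_nonneg denom_pos.le hI.slopeB_nonneg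
  rw [scaledPeriodCost_add_gain, scaledPeriodCost]
  refine max_le_max ?_ ?_
  · nlinarith [neg_abs_le u]
  · nlinarith [le_abs_self u]

/-- The sign in `signedSolution` is positive exactly when the backordering branch is strictly
larger, so the deviation realises the branch that determines the gain. -/
theorem le_scaledPeriodCost (t : ℕ) :
    I.scaledPeriodCost k t 0 + (I.knapsack k).gain t ((I.knapsack k).solution t) ≤
      I.scaledPeriodCost k t ((I.knapsack k).signedSolution t) := by
  have h0 : (I.knapsack k).α t = I.denom * I.slope t := rfl
  have h1 : (I.knapsack k).β = I.denom * I.slopeB := rfl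
  have h2 : (I.knapsack k).z t = I.offset k t := rfl
  have hz : max 0 (I.offset k t) - max 0 (-I.offset k t) =
      I.slope t * I.excess t * I.scale k + I.slopeB * I.excess t * I.scale k := by
    have : I.offset k t =
        I.slope t * I.excess t * I.scale k + I.slopeB * I.excess t * I.scale k := by
      rw [offset]
      ring
    rw [← this]
    omega
  rw [scaledPeriodCost_add_gain, scaledPeriodCost, Knapsack.signedSolution, h0, h1, h2]
  generalize (I.knapsack k).solution t = u
  split_ifs with h
  · refine max_le (le_max_of_le_right ?_) (le_max_right _ _)
    have h' : I.slope t * I.excess t * I.scale k + I.denom * I.slope t * u ≤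
        I.denom * I.slopeB * u - I.slopeB * I.excess t * I.scale k := by linarith
    exact_mod_cast h'
  · push_cast
    rw [mul_neg, sub_neg_eq_add]
    refine max_le (le_max_left _ _) (le_max_of_le_left ?_)
    have h' : I.denom * I.slopeB * u - I.slopeB * I.excess t * I.scale k ≤
        I.slope t * I.excess t * I.scale k + I.denom * I.slope t * u := by linarith
    exact_mod_cast h'

/-- The scaled cost of a scenario. -/
theorem costScale_mul_cost (D : Fin I.T → ℝ) :
    I.costScale k * I.cost D = ∑ t, (I.costScale k * I.fixedCost t +
      I.scaledPeriodCost k t ((D t - I.nominal t) * I.scale k)) := by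
  rw [cost, Finset.mul_sum]
  exact Finset.sum_congr rfl fun t _ => costScale_mul_period_cost t (D t)

theorem costScale_mul_cost_nominal : I.costScale k * I.cost I.nominal =
    ∑ t : Fin I.T, (I.costScale k * I.fixedCost t + I.scaledPeriodCost k t 0) := by
  simp only [costScale_mul_cost, sub_self, zero_mul]

variable (I k) in
/-- The scenario returned by the approximation scheme. -/
noncomputable def output (t : Fin I.T) : ℝ :=
  I.nominal t + (I.knapsack k).signedSolution t / I.scale k

theorem output_eq {a b : ℤ} (t : Fin I.T)
    (ha : a = I.demandNum t * I.scale k + (I.knapsack k).signedSolution t * I.demandDen t)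
    (hb : b = I.demandDen t * I.scale k) : 0 < b ∧ I.output k t = (a : ℝ) / b := by
  have h1 : 0 < I.demandDen t := demandDen_pos t.2
  have h2 := scale_pos (I := I) (k := k)
  refine ⟨hb ▸ mul_pos h1 h2, ?_⟩
  have h3 : I.nominal t = (I.demandNum t : ℝ) / I.demandDen t := by
    rw [nominal, demandNum, demandDen, toArr_lt t.2, toArr_lt t.2, Rat.cast_def]
    simp
  rw [output, ha, hb, h3]
  have h1' : (I.demandDen t : ℝ) ≠ 0 := by exact_mod_cast h1.ne'
  have h2' : (I.scale k : ℝ) ≠ 0 := by exact_mod_cast h2.ne'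
  push_cast
  field_simp

theorem output_sub_nominal_mul_scale (t : Fin I.T) :
    (I.output k t - I.nominal t) * I.scale k = (I.knapsack k).signedSolution t := by
  have h2' : (I.scale k : ℝ) ≠ 0 := by exact_mod_cast (scale_pos (I := I) (k := k)).ne'
  rw [output, add_sub_cancel_left, div_mul_cancel₀ _ h2']

/-! ### Feasibility, approximation ratio and existence of the optimum. -/

namespace Admissible

variable (hI : I.Admissible)

include hI

/-- Monotonicity comes for free: the upper end of each interval is at most the lower end of the
next. -/
theorem mem_Uc_of_abs_le {D : Fin I.T → ℝ} (h₁ : ∀ t, |D t - I.nominal t| ≤ I.Δ t)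
    (h₂ : ∑ t, |D t - I.nominal t| ≤ I.Γ) : D ∈ I.Uc := by
  refine ⟨fun s t hst => ?_, fun t => ?_, h₂⟩
  · have h : I.nominal s + I.Δ s ≤ I.nominal t - I.Δ t := by
      rw [nominal, nominal]
      exact_mod_cast hI.nonoverlapping s t hst
    linarith [(abs_le.1 (h₁ s)).2, (abs_le.1 (h₁ t)).1]
  · have := abs_le.1 (h₁ t)
    constructor <;> linarith

theorem abs_output_sub (t : Fin I.T) :
    |I.output k t - I.nominal t| * I.scale k = (I.knapsack k).solution t := by
  have h : (0 : ℝ) < I.scale k := by exact_mod_cast scale_pos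
  have h0 : 0 ≤ (I.knapsack k).solution t := Knapsack.solution_nonneg hI.regular t.2
  have h1 : |(I.knapsack k).signedSolution t| = (I.knapsack k).solution t := by
    rw [Knapsack.signedSolution]
    split_ifs
    · exact abs_of_nonneg h0
    · rw [abs_neg, abs_of_nonneg h0]
  rw [← h1, Int.cast_abs, ← output_sub_nominal_mul_scale, abs_mul, abs_of_pos h]

theorem output_mem : I.output k ∈ I.Uc := by
  have h : (0 : ℝ) < I.scale k := by exact_mod_cast scale_pos
  refine hI.mem_Uc_of_abs_le (fun t => ?_) ?_
  · refine le_of_mul_le_mul_right ?_ h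
    rw [hI.abs_output_sub]
    have h1 := Knapsack.solution_le (hI.regular (k := k)) t.2
    have h2 : (I.knapsack k).δ t = I.Δ t * I.scale k := by
      simp only [knapsack, deviation, toArr_lt t.2]
    rw [h2] at h1
    exact_mod_cast h1
  · refine le_of_mul_le_mul_right ?_ h
    rw [Finset.sum_mul]
    simp only [hI.abs_output_sub]
    have h1 := Knapsack.sum_solution_le (hI.regular (k := k))
    rw [show (I.knapsack k).T = I.T from rfl, Finset.sum_range] at h1
    exact_mod_cast h1

/-- The returned scenario is optimal up to the factor `1 + 1 / k`. -/
theorem cost_le_output (hk : 0 < k) {D : Fin I.T → ℝ} (hD : D ∈ I.Uc) :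
    I.cost D ≤ (1 + 1 / k) * I.cost (I.output k) := by
  have hs : (0 : ℝ) < I.scale k := by exact_mod_cast scale_pos
  have hc : (0 : ℝ) < I.costScale k := by exact_mod_cast costScale_pos
  have hk' : (0 : ℝ) < k := by exact_mod_cast hk
  obtain ⟨u, hu⟩ : ∃ u : ℕ → ℝ, ∀ t : Fin I.T, u t = |D t - I.nominal t| * I.scale k :=
    ⟨fun t => if h : t < I.T then |D ⟨t, h⟩ - I.nominal ⟨t, h⟩| * I.scale k else 0,
      fun t => dif_pos t.2⟩
  have hgain : ∀ t, (I.knapsack k).gain t (min ((I.knapsack k).δ t) (I.knapsack k).G : ℤ) =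
      I.singleGain k t := fun t => by
    simp only [Knapsack.gain, singleGain, knapsack]
    push_cast
    rfl
  -- The resolution is `k * T + 1`: at least `k * T` for the error estimate, and positive even when
  -- `T = 0`.
  have hmain := Knapsack.gain_le_solution (hI.regular (k := k)) hk (Nat.le_succ _)
    (fun t ht => by rw [hgain]; exact_mod_cast singleGain_le ht)
    ((maxSingleGain_eq I.T).imp id fun ⟨t, ht, h⟩ => ⟨t, ht, by rw [hgain, h]; rfl⟩)
    (u := u) ?_ ?_
  · rw [show (I.knapsack k).T = I.T from rfl, Finset.sum_range, Finset.sum_range] at hmain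
    have hup : I.costScale k * I.cost D ≤ I.costScale k * I.cost I.nominal +
        ∑ t : Fin I.T, (I.knapsack k).gain t (u t) := by
      rw [costScale_mul_cost, costScale_mul_cost_nominal, ← Finset.sum_add_distrib]
      refine Finset.sum_le_sum fun t _ => ?_
      have h := hI.scaledPeriodCost_le (k := k) t ((D t - I.nominal t) * I.scale k)
      rw [abs_mul, abs_of_pos hs, ← hu] at h
      linarith
    have hlow : I.costScale k * I.cost I.nominal +
        ∑ t : Fin I.T, (I.knapsack k).gain t ((I.knapsack k).solution t) ≤
          I.costScale k * I.cost (I.output k) := by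
      rw [costScale_mul_cost_nominal, costScale_mul_cost, ← Finset.sum_add_distrib]
      refine Finset.sum_le_sum fun t _ => ?_
      have h := le_scaledPeriodCost (I := I) (k := k) t
      rw [output_sub_nominal_mul_scale]
      linarith
    -- The nominal cost enters `hup` with factor 1, but it is multiplied by `1 + 1 / k` on the other
    -- side; its nonnegativity covers the difference.
    have hnom : 0 ≤ 1 / (k : ℝ) * (I.costScale k * I.cost I.nominal) :=
      mul_nonneg (by positivity) (mul_nonneg hc.le hI.cost_nominal_nonneg)
    refine le_of_mul_le_mul_left ?_ hc
    have := mul_le_mul_of_nonneg_left hlow (by positivity : (0 : ℝ) ≤ 1 + 1 / k)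
    rw [mul_left_comm]
    linarith
  · intro t ht
    have ht' : t < I.T := ht
    have h1 := hu ⟨t, ht'⟩
    have h2 := hD.2.1 ⟨t, ht'⟩
    simp only at h1
    rw [h1]
    refine ⟨by positivity, ?_⟩
    have h3 : (I.knapsack k).δ t = I.Δ ⟨t, ht'⟩ * I.scale k := by
      simp only [knapsack, deviation, toArr_lt ht']
    rw [h3]
    push_cast
    refine mul_le_mul_of_nonneg_right (abs_le.2 ⟨?_, ?_⟩) hs.le <;> linarith [h2.1, h2.2]
  · rw [show (I.knapsack k).T = I.T from rfl, Finset.sum_range]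
    simp only [hu]
    rw [← Finset.sum_mul]
    have h1 := mul_le_mul_of_nonneg_right hD.2.2 hs.le
    refine h1.trans (le_of_eq ?_)
    simp only [knapsack]
    push_cast
    rfl

/-- The uncertainty set is a nonempty closed part of a compact box, and the cost is continuous. -/
theorem exists_isOPT : ∃ v, I.IsOPT v := by
  have hne : I.Uc.Nonempty := ⟨I.nominal, hI.mem_Uc_of_abs_le (by simp) (by simp)⟩
  have hcomp : IsCompact I.Uc := by
    have h : I.Uc = {D | (∀ s t : Fin I.T, (s : ℕ) + 1 = t → D s ≤ D t) ∧
        ∑ t, |D t - I.nominal t| ≤ I.Γ} ∩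
        Set.univ.pi fun t => Set.Icc (I.nominal t - I.Δ t) (I.nominal t + I.Δ t) := by
      ext D
      simp only [Uc, Set.mem_ofPred_eq, Set.mem_inter_iff, Set.mem_pi, Set.mem_univ, true_imp_iff]
      tauto
    rw [h]
    refine (isCompact_univ_pi fun t => isCompact_Icc).inter_left ?_
    simp only [Set.ofPred_and, Set.ofPred_forall]
    refine IsClosed.inter ?_ (isClosed_le (by fun_prop) continuous_const)
    exact isClosed_iInter fun s => isClosed_iInter fun t => isClosed_iInter fun _ =>
      isClosed_le (by fun_prop) (by fun_prop)
  have hcont : Continuous I.cost := by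
    unfold cost
    simp only [period_cost_eq]
    fun_prop
  exact (hcomp.image hcont).exists_isGreatest (hne.image _)

end Admissible

/-- The running time is polynomial in the size and the accuracy parameter. -/
theorem exists_time_bound : ∃ c d : ℕ, ∀ (I : AdvInstance) (k : ℕ),
    scheme.timeWeight (I.knapsack k).width * (25 * (I.size + k)) ≤ c * (I.size + k + 1) ^ d := by
  obtain ⟨c, d, h⟩ := scheme.exists_timeWeight_le
  -- The loop bound `width` is cubic in the size and `k`, which gives `3 * d`; one further power and
  -- the 25 come from the number of digits.
  refine ⟨25 * c, 3 * d + 1, fun I k => ?_⟩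
  have hT : I.T ≤ I.size := by
    rw [size]
    omega
  have h0 := I.size_pos
  have hw : (I.knapsack k).width + 1 ≤ (I.size + k + 1) ^ 3 := by
    change I.T * (k * I.T + 1) + 1 + 1 ≤ _
    have h1 : I.T ≤ I.size + k := by omega
    have h2 : k ≤ I.size + k := by omega
    have h3 : 1 ≤ I.size + k := by omega
    generalize I.size + k = n at *
    have h4 : I.T * (k * I.T + 1) ≤ n * (n * n + 1) := by gcongr
    nlinarith
  calc scheme.timeWeight (I.knapsack k).width * (25 * (I.size + k))
      ≤ c * ((I.size + k + 1) ^ 3) ^ d * (25 * (I.size + k + 1)) := by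
        refine Nat.mul_le_mul ((h _).trans ?_) (by omega)
        gcongr
    _ = _ := by rw [← pow_mul]; ring

end AdvInstance

theorem mainTheorem8 : ∃ P : RAM.Prog, IsAdvFPTAS P := by
  obtain ⟨c, d, hcd⟩ := AdvInstance.exists_time_bound
  refine ⟨AdvInstance.scheme,
    -- The 2 consists of the 1 lost in rounding `1 / ε` up and the 1 in `exists_time_bound`.
    .C (c : ℝ) * (.X 0 + .X 1 + .C 2) ^ d, fun I hI ε hε => ?_⟩
  have hk : 0 < ⌈1 / ε⌉₊ := Nat.ceil_pos.2 (by positivity)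
  obtain ⟨s, n, hexec, hn, -, hout⟩ := AdvInstance.runs_scheme (k := ⌈1 / ε⌉₊) hI
  obtain ⟨v, hv⟩ := hI.exists_isOPT
  refine ⟨s, n, I.output ⌈1 / ε⌉₊, v, hexec, ?_, fun t => ?_, hI.output_mem, hv, ?_⟩
  · have h1 : (n : ℝ) ≤ c * (I.size + ⌈1 / ε⌉₊ + 1) ^ d := by
      exact_mod_cast hn.trans (hcd I _)
    have h2 : (⌈1 / ε⌉₊ : ℝ) ≤ 1 / ε + 1 := (Nat.ceil_lt_add_one (by positivity)).le
    have h3 : (I.size + ⌈1 / ε⌉₊ + 1 : ℝ) ≤ I.size + 1 / ε + 2 := by linarith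
    refine h1.trans ?_
    simp only [map_mul, map_pow, map_add, MvPolynomial.eval_C, MvPolynomial.eval_X,
      Matrix.cons_val_zero, Matrix.cons_val_one]
    gcongr
  · exact AdvInstance.output_eq t (hout t t.2).1 (hout t t.2).2
  · obtain ⟨D, hD, rfl⟩ := hv.1
    refine (hI.cost_le_output hk hD).trans ?_
    -- The factor `1 + 1 / k` can be enlarged to `1 + ε` only if the returned cost is nonnegative;
    -- comparison with the nominal scenario shows this.
    have h0 : 0 ≤ I.cost (I.output ⌈1 / ε⌉₊) := by
      have h := hI.cost_nominal_nonneg.trans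
        (hI.cost_le_output hk (hI.mem_Uc_of_abs_le (D := I.nominal) (by simp) (by simp)))
      exact nonneg_of_mul_nonneg_right h (by positivity)
    have h1 : 1 / (⌈1 / ε⌉₊ : ℝ) ≤ ε := by
      rw [one_div_le (by exact_mod_cast hk) hε]
      exact Nat.le_ceil _
    gcongr
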